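/- For $N\ge 2$ let $S^{N-1}_{\mathbb R}\subset\mathbb R^N$ and $S^{N-1}_{\mathbb C}\subset\mathbb C^N$ be the usual unit spheres, with $C(S^{N-1}_{\mathbb R})$, $C(S^{N-1}_{\mathbb C})$ their algebras of continuous complex functions and with their standard coordinate functions. Define eight further noncommutative spheres $S$, each through a universal unital $C^*$-algebra $C(S)$ generated by $N$ coordinates. In the real case the coordinates $x_1,\dots,x_N$ satisfy $x_i=x_i^*$ and $\sum_i x_i^2=1$. In the complex case the coordinates $z_1,\dots,z_N$ satisfy $\sum_i z_iz_i^*=\sum_i z_i^*z_i=1$. In addition one imposes: * $S^{N-1}_{\mathbb R,+}$ and $S^{N-1}_{\mathbb C,+}$: no further relations; * $S^{N-1}_{\mathbb R,*}$: $abc=cba$ for all $a,b,c\in\{x_i\}$; * $S^{N-1}_{\mathbb C,**}$: $abc=cba$ for all $a,b,c\in\{z_i,z_i^*\}$; * $\bar S^{N-1}_{\mathbb R}$: $ab=-ba$ for all distinct $a,b\in\{x_i\}$; * $\bar S^{N-1}_{\mathbb C}$: for $a,b\in\{z_i\}$ and $\alpha\in\{a,a^*\}$, $\beta\in\{b,b^*\}$,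 $\alpha\beta=-\beta\alpha$ if $a,b$ are distinct, and $\alpha\beta=\beta\alpha$ otherwise; * $\bar S^{N-1}_{\mathbb R,*}$: for $a,b,c\in\{x_i\}$, $abc=-cba$ if $a,b,c$ are (pairwise) distinct, and $abc=cba$ otherwise; * $\bar S^{N-1}_{\mathbb C,**}$: for $a,b,c\in\{z_i\}$ and $\alpha\in\{a,a^*\}$, $\beta\in\{b,b^*\}$, $\gamma\in\{c,c^*\}$, $\alpha\beta\gamma=-\gamma\beta\alpha$ if $a,b,c$ are (pairwise) distinct, and $\alpha\beta\gamma=\gamma\beta\alpha$ otherwise. For two of these spheres, $X\subset Y$ means that there is a surjective unital $*$-homomorphism $C(Y)\to C(X)$ mapping the $i$-th coordinate to the $i$-th coordinate for all $i$. The inclusion is proper if this homomorphism is not injective, and one writes $X=Y$ if it is an isomorphism. **Theorem.** Consider the 13 inclusions $$S^{N-1}_{\mathbb C}\subset S^{N-1}_{\mathbb C,**}\subset S^{N-1}_{\mathbb C,+}\supset \bar S^{N-1}_{\mathbb C,**}\supset\bar S^{N-1}_{\mathbb C},\qquad S^{N-1}_{\mathbb R}\subset S^{N-1}_{\mathbb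 R,*}\subset S^{N-1}_{\mathbb R,+}\supset \bar S^{N-1}_{\mathbb R,*}\supset\bar S^{N-1}_{\mathbb R},$$ $$S^{N-1}_{\mathbb R}\subset S^{N-1}_{\mathbb C},\quad S^{N-1}_{\mathbb R,*}\subset S^{N-1}_{\mathbb C,**},\quad S^{N-1}_{\mathbb R,+}\subset S^{N-1}_{\mathbb C,+},\quad \bar S^{N-1}_{\mathbb R,*}\subset\bar S^{N-1}_{\mathbb C,**},\quad \bar S^{N-1}_{\mathbb R}\subset\bar S^{N-1}_{\mathbb C}.$$ 1. For every $N\ge3$, all these 13 inclusions hold and are proper. 2. For $N=2$, one has $S^1_{\mathbb R,*}=\bar S^1_{\mathbb R,*}=S^1_{\mathbb R,+}$, and the other 11 inclusions hold and are proper. -/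

import Mathlib

noncomputable section

/-! ### The free unital `*`-algebra on `N` generators -/

/-- The free unital complex `*`-algebra `ℂ⟨z₁, …, z_N, z₁*, …, z_N*⟩`: the free algebra on the letters
`(i, false)`, standing for `z_i`, and `(i, true)`, standing for `z_i*`. -/
def FreeStarAlg (N : ℕ) : Type := FreeAlgebra ℂ (Fin N × Bool)

namespace FreeStarAlg

variable {N : ℕ}

instance : Ring (FreeStarAlg N) := inferInstanceAs (Ring (FreeAlgebra ℂ (Fin N × Bool)))

instance : Algebra ℂ (FreeStarAlg N) := inferInstanceAs (Algebra ℂ (FreeAlgebra ℂ (Fin N × Bool)))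

/-- The letter `z_i` (for `e = false`) or `z_i*` (for `e = true`). -/
def letter (i : Fin N) (e : Bool) : FreeStarAlg N := FreeAlgebra.ι ℂ (i, e)

/-- The generator `z_i`. -/
def z (i : Fin N) : FreeStarAlg N := letter i false

/-- The opposite algebra, with complex scalars acting through complex conjugation. -/
def ConjOp (N : ℕ) : Type := (FreeStarAlg N)ᵐᵒᵖ

instance : Ring (ConjOp N) := inferInstanceAs (Ring (FreeStarAlg N)ᵐᵒᵖ)

instance : Algebra ℂ (ConjOp N) :=
  RingHom.toAlgebra' ((algebraMap ℂ (FreeStarAlg N)ᵐᵒᵖ).comp (starRingEnd ℂ))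
    (fun c x => Algebra.commutes (R := ℂ) (A := (FreeStarAlg N)ᵐᵒᵖ) (starRingEnd ℂ c) x)

/-- The involution, as a homomorphism: it exchanges `z_i` and `z_i*`, conjugates the scalars and
reverses products. -/
def starHom (N : ℕ) : FreeStarAlg N →ₐ[ℂ] ConjOp N :=
  FreeAlgebra.lift ℂ (fun x : Fin N × Bool => (MulOpposite.op (letter x.1 (!x.2)) : ConjOp N))

/-- The involution of the free `*`-algebra. -/
def conj (a : FreeStarAlg N) : FreeStarAlg N := MulOpposite.unop (starHom N a)

theorem conj_letter (i : Fin N) (e : Bool) : conj (letter i e) = letter i (!e) := by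
  have h : starHom N (letter i e) = (MulOpposite.op (letter i (!e)) : ConjOp N) :=
    FreeAlgebra.lift_ι_apply _ _
  rw [conj, h]
  rfl

theorem conj_add (a b : FreeStarAlg N) : conj (a + b) = conj a + conj b := by
  rw [conj, map_add]
  rfl

theorem conj_mul (a b : FreeStarAlg N) : conj (a * b) = conj b * conj a := by
  rw [conj, map_mul]
  rfl

theorem conj_algebraMap (c : ℂ) :
    conj (algebraMap ℂ (FreeStarAlg N) c) = algebraMap ℂ (FreeStarAlg N) (star c) := by
  rw [conj, AlgHom.commutes (starHom N) c]
  rfl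

theorem conj_conj (a : FreeStarAlg N) : conj (conj a) = a := by
  refine FreeAlgebra.induction ℂ (Fin N × Bool) (motive := fun a => conj (conj a) = a)
    ?_ ?_ ?_ ?_ a
  · intro c
    exact (congrArg conj (conj_algebraMap c)).trans
      ((conj_algebraMap _).trans (congrArg _ (star_star c)))
  · rintro ⟨i, e⟩
    exact (congrArg conj (conj_letter i e)).trans
      ((conj_letter i _).trans (congrArg _ (Bool.not_not e)))
  · intro a b ha hb
    exact (congrArg conj (conj_mul a b)).trans ((conj_mul _ _).trans (congrArg₂ _ ha hb))
  · intro a b ha hb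
    exact (congrArg conj (conj_add a b)).trans ((conj_add _ _).trans (congrArg₂ _ ha hb))

instance : StarRing (FreeStarAlg N) where
  star := conj
  star_involutive := conj_conj
  star_mul := conj_mul
  star_add := conj_add

theorem star_letter (i : Fin N) (e : Bool) : star (letter i e) = letter i (!e) := conj_letter i e

instance : StarModule ℂ (FreeStarAlg N) where
  star_smul c a := by
    have h : star (algebraMap ℂ (FreeStarAlg N) c) = algebraMap ℂ (FreeStarAlg N) (star c) :=
      conj_algebraMap c
    rw [Algebra.smul_def, star_mul, Algebra.smul_def, h, Algebra.commutes]

end FreeStarAlg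

/-! ### C*-seminorms and their completions -/

/-- A C*-seminorm on a complex `*`-algebra. -/
structure CStarSeminorm (P : Type) [Ring P] [Algebra ℂ P] [StarRing P] extends Seminorm ℂ P where
  mul_le' : ∀ a b, toFun (a * b) ≤ toFun a * toFun b
  star_mul_self' : ∀ a, toFun (star a * a) = toFun a * toFun a

namespace CStarSeminorm

variable {P : Type} [Ring P] [Algebra ℂ P] [StarRing P]

instance : CoeFun (CStarSeminorm P) (fun _ => P → ℝ) := ⟨fun q => q.toFun⟩

theorem nonneg (q : CStarSeminorm P) (a : P) : 0 ≤ q a := apply_nonneg q.toSeminorm a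

theorem star_eq (q : CStarSeminorm P) (a : P) : q (star a) = q a := by
  have key : ∀ b, q b ≤ q (star b) := by
    intro b
    by_contra! h
    have h1 := q.star_mul_self' b
    have h2 := q.mul_le' (star b) b
    nlinarith [q.nonneg b, q.nonneg (star b)]
  refine le_antisymm ?_ (key a)
  simpa using key (star a)

/-- The `*`-algebra `P`, seen as a seminormed algebra through the C*-seminorm `q`. -/
def Carrier (_q : CStarSeminorm P) : Type := P

variable (q : CStarSeminorm P)

instance : Ring q.Carrier := inferInstanceAs (Ring P)

instance : Algebra ℂ q.Carrier := inferInstanceAs (Algebra ℂ P)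

instance : StarRing q.Carrier := inferInstanceAs (StarRing P)

instance [StarModule ℂ P] : StarModule ℂ q.Carrier := inferInstanceAs (StarModule ℂ P)

instance : SeminormedAddCommGroup q.Carrier :=
  fast_instance% { q.toSeminorm.toAddGroupSeminorm.toSeminormedAddCommGroup,
    (inferInstance : AddCommGroup q.Carrier) with }

theorem norm_def (a : q.Carrier) : ‖a‖ = q.toFun a := rfl

instance : SeminormedRing q.Carrier :=
  { (inferInstance : SeminormedAddCommGroup q.Carrier), (inferInstance : Ring q.Carrier) with
    norm_mul_le := q.mul_le' }

instance : NormedAlgebra ℂ q.Carrier where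
  norm_smul_le c a := (q.toSeminorm.smul' c a).le

instance : NormedStarGroup q.Carrier where
  norm_star_le a := (q.star_eq a).le

theorem isometry_star : Isometry (star : q.Carrier → q.Carrier) :=
  AddMonoidHomClass.isometry_of_norm (starAddEquiv (R := q.Carrier)) (fun a => q.star_eq a)

/-- The completion of `P` for the C*-seminorm `q` (elements of seminorm zero being divided out). -/
def CStarCompletion : Type := UniformSpace.Completion q.Carrier

/-- The canonical map from `P` to its completion. -/
def toCompletion (a : P) : q.CStarCompletion := UniformSpace.Completion.coe' (α := q.Carrier) a

instance : NormedRing q.CStarCompletion :=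
  inferInstanceAs (NormedRing (UniformSpace.Completion q.Carrier))

instance : CompleteSpace q.CStarCompletion :=
  inferInstanceAs (CompleteSpace (UniformSpace.Completion q.Carrier))

instance : Algebra ℂ q.CStarCompletion :=
  inferInstanceAs (Algebra ℂ (UniformSpace.Completion q.Carrier))

instance : NormedAlgebra ℂ q.CStarCompletion where
  norm_smul_le c x := norm_smul_le (β := UniformSpace.Completion q.Carrier) c x

theorem denseRange_toCompletion : DenseRange q.toCompletion :=
  UniformSpace.Completion.denseRange_coe (α := q.Carrier)

theorem norm_toCompletion (a : P) : ‖q.toCompletion a‖ = q a :=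
  UniformSpace.Completion.norm_coe (E := q.Carrier) a

theorem toCompletion_add (a b : P) :
    q.toCompletion (a + b) = q.toCompletion a + q.toCompletion b :=
  UniformSpace.Completion.coe_add (α := q.Carrier) a b

theorem toCompletion_sub (a b : P) :
    q.toCompletion (a - b) = q.toCompletion a - q.toCompletion b :=
  UniformSpace.Completion.coe_sub (α := q.Carrier) a b

theorem toCompletion_mul (a b : P) :
    q.toCompletion (a * b) = q.toCompletion a * q.toCompletion b :=
  UniformSpace.Completion.coe_mul (α := q.Carrier) a b

theorem toCompletion_one : q.toCompletion 1 = 1 :=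
  UniformSpace.Completion.coe_one (α := q.Carrier)

theorem toCompletion_smul (c : ℂ) (a : P) :
    q.toCompletion (c • a) = c • q.toCompletion a :=
  UniformSpace.Completion.coe_smul (X := q.Carrier) c a

/-- The involution of the completion, extending that of `P` by continuity. -/
instance : Star q.CStarCompletion where
  star := UniformSpace.Completion.map (star : q.Carrier → q.Carrier)

theorem continuous_star' : Continuous (star : q.CStarCompletion → q.CStarCompletion) :=
  UniformSpace.Completion.continuous_map (α := q.Carrier) (β := q.Carrier)

theorem toCompletion_star (a : P) : q.toCompletion (star a) = star (q.toCompletion a) :=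
  (UniformSpace.Completion.map_coe (α := q.Carrier) (β := q.Carrier)
    q.isometry_star.uniformContinuous a).symm

instance : StarRing q.CStarCompletion where
  star_involutive x := by
    refine q.denseRange_toCompletion.induction_on x
      (isClosed_eq (q.continuous_star'.comp q.continuous_star') continuous_id) fun a => ?_
    rw [← toCompletion_star, ← toCompletion_star, star_star]
  star_mul x y := by
    have hs := q.continuous_star'
    refine q.denseRange_toCompletion.induction_on₂ ?_ (fun a b => ?_) x y
    · exact isClosed_eq (hs.comp (continuous_fst.mul continuous_snd))
        ((hs.comp continuous_snd).mul (hs.comp continuous_fst))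
    · rw [← toCompletion_mul, ← toCompletion_star, ← toCompletion_star, ← toCompletion_star,
        ← toCompletion_mul, star_mul]
  star_add x y := by
    have hs := q.continuous_star'
    refine q.denseRange_toCompletion.induction_on₂ ?_ (fun a b => ?_) x y
    · exact isClosed_eq (hs.comp (continuous_fst.add continuous_snd))
        ((hs.comp continuous_fst).add (hs.comp continuous_snd))
    · rw [← toCompletion_add, ← toCompletion_star, ← toCompletion_star, ← toCompletion_star,
        ← toCompletion_add, star_add]

instance : CStarRing q.CStarCompletion where
  norm_mul_self_le x := by
    have hs := q.continuous_star'
    refine q.denseRange_toCompletion.induction_on x ?_ fun a => ?_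
    · exact isClosed_le (continuous_norm.mul continuous_norm)
        (continuous_norm.comp (hs.mul continuous_id))
    · rw [← toCompletion_star, ← toCompletion_mul, norm_toCompletion, norm_toCompletion]
      exact (q.star_mul_self' a).ge

variable [StarModule ℂ P]

instance : StarModule ℂ q.CStarCompletion where
  star_smul c x := by
    have hs := q.continuous_star'
    refine q.denseRange_toCompletion.induction_on x ?_ fun a => ?_
    · exact isClosed_eq (hs.comp (continuous_id.const_smul c)) (hs.const_smul (star c))
    · rw [← toCompletion_smul, ← toCompletion_star, ← toCompletion_star, ← toCompletion_smul,
        star_smul]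

instance : CStarAlgebra q.CStarCompletion where

end CStarSeminorm

/-! ### Universal C*-algebras -/

section Universal

variable {P : Type} [Ring P] [Algebra ℂ P] [StarRing P]

/-- The values at `a` of all C*-seminorms for which the relations `r = 0`, `r ∈ R`, hold. -/
def seminormValues (R : Set P) (a : P) : Set ℝ :=
  {t | ∃ q : CStarSeminorm P, (∀ r ∈ R, q r = 0) ∧ t = q a}

/-- The relations `r = 0`, `r ∈ R`, bound the norm of every element of `P`: this is the condition
under which the universal C*-algebra with these relations exists. -/
def NormBounding (R : Set P) : Prop := ∀ a : P, BddAbove (seminormValues R a)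

/-- The zero seminorm, which corresponds to the zero algebra. -/
def CStarSeminorm.zero : CStarSeminorm P where
  toSeminorm := 0
  mul_le' _ _ := (mul_zero (0 : ℝ)).ge
  star_mul_self' _ := (mul_zero (0 : ℝ)).symm

theorem seminormValues_nonempty (R : Set P) (a : P) : (seminormValues R a).Nonempty :=
  ⟨0, CStarSeminorm.zero, fun _ _ => rfl, rfl⟩

theorem sSup_seminormValues_nonneg (R : Set P) (a : P) : 0 ≤ sSup (seminormValues R a) := by
  refine Real.sSup_nonneg ?_
  rintro _ ⟨q, -, rfl⟩
  exact q.nonneg a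

theorem le_sSup_seminormValues {R : Set P} (hR : NormBounding R) (q : CStarSeminorm P)
    (hq : ∀ r ∈ R, q r = 0) (a : P) : q a ≤ sSup (seminormValues R a) :=
  le_csSup (hR a) ⟨q, hq, rfl⟩

/-- The largest C*-seminorm for which the relations `r = 0`, `r ∈ R`, hold. -/
def maxCStarSeminorm (R : Set P) (hR : NormBounding R) : CStarSeminorm P where
  toFun a := sSup (seminormValues R a)
  map_zero' := by
    refine le_antisymm (csSup_le (seminormValues_nonempty R 0) ?_)
      (sSup_seminormValues_nonneg R 0)
    rintro _ ⟨q, -, rfl⟩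
    exact (map_zero q.toSeminorm).le
  add_le' a b := by
    refine csSup_le (seminormValues_nonempty R _) ?_
    rintro _ ⟨q, hq, rfl⟩
    exact (map_add_le_add q.toSeminorm a b).trans
      (add_le_add (le_sSup_seminormValues hR q hq a) (le_sSup_seminormValues hR q hq b))
  neg' a := by
    congr 1
    ext t
    refine exists_congr fun q => and_congr_right fun _ => ?_
    rw [show q (-a) = q a from map_neg_eq_map q.toSeminorm a]
  smul' c a := by
    have h1 : ∀ (c : ℂ) (a : P),
        sSup (seminormValues R (c • a)) ≤ ‖c‖ * sSup (seminormValues R a) := by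
      intro c a
      refine csSup_le (seminormValues_nonempty R _) ?_
      rintro _ ⟨q, hq, rfl⟩
      rw [show q (c • a) = ‖c‖ * q a from q.toSeminorm.smul' c a]
      exact mul_le_mul_of_nonneg_left (le_sSup_seminormValues hR q hq a) (norm_nonneg c)
    refine le_antisymm (h1 c a) ?_
    rcases eq_or_ne c 0 with rfl | hc
    · simpa using sSup_seminormValues_nonneg R ((0 : ℂ) • a)
    · have h2 := h1 c⁻¹ (c • a)
      rw [inv_smul_smul₀ hc, norm_inv] at h2
      rwa [← le_inv_mul_iff₀ (norm_pos_iff.mpr hc)]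
  mul_le' a b := by
    refine csSup_le (seminormValues_nonempty R _) ?_
    rintro _ ⟨q, hq, rfl⟩
    exact (q.mul_le' a b).trans (mul_le_mul (le_sSup_seminormValues hR q hq a)
      (le_sSup_seminormValues hR q hq b) (q.nonneg b) (sSup_seminormValues_nonneg R a))
  star_mul_self' a := by
    have h0 := sSup_seminormValues_nonneg R a
    refine le_antisymm (csSup_le (seminormValues_nonempty R _) ?_) ?_
    · rintro _ ⟨q, hq, rfl⟩
      rw [q.star_mul_self' a]
      have := le_sSup_seminormValues hR q hq a
      exact mul_le_mul this this (q.nonneg a) h0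
    · rw [← pow_two, ← Real.le_sqrt h0 (sSup_seminormValues_nonneg R _)]
      refine csSup_le (seminormValues_nonempty R _) ?_
      rintro _ ⟨q, hq, rfl⟩
      refine Real.le_sqrt_of_sq_le ?_
      rw [pow_two, ← q.star_mul_self' a]
      exact le_sSup_seminormValues hR q hq _

end Universal

/-! ### Noncommutative spaces with coordinates -/

/-- A noncommutative compact space `X` with `N` coordinates: a unital C*-algebra `C(X)` together
with `N` privileged elements. -/
structure CoordSpace (N : ℕ) where
  /-- The algebra `C(X)`. -/
  fn : Type
  [cstar : CStarAlgebra fn]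
  /-- The coordinates `x_1, …, x_N`. -/
  coord : Fin N → fn

attribute [instance] CoordSpace.cstar

namespace CoordSpace

variable {N : ℕ}

/-- `X ⊂ Y` as a proper inclusion: there is a surjective morphism `C(Y) → C(X)` mapping coordinates
to coordinates, and it is not an isomorphism. -/
def ProperSubspace (X Y : CoordSpace N) : Prop :=
  ∃ φ : Y.fn →⋆ₐ[ℂ] X.fn,
    (∀ i, φ (Y.coord i) = X.coord i) ∧ Function.Surjective φ ∧ ¬ Function.Injective φ

/-- `X = Y`: the spaces are identified by an isomorphism `C(Y) → C(X)` mapping coordinates to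
coordinates. -/
def Same (X Y : CoordSpace N) : Prop :=
  ∃ φ : Y.fn ≃⋆ₐ[ℂ] X.fn, ∀ i, φ (Y.coord i) = X.coord i

/-- The space `X` with `C(X) = C*(z_1, …, z_N | r = 0 for r ∈ R)`, a universal C*-algebra. -/
def universal (R : Set (FreeStarAlg N)) (hR : NormBounding R) : CoordSpace N where
  fn := (maxCStarSeminorm R hR).CStarCompletion
  coord i := (maxCStarSeminorm R hR).toCompletion (FreeStarAlg.z i)

end CoordSpace

/-! ### The ten spheres -/

namespace Sphere

open FreeStarAlg

variable {N : ℕ}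

/-- The relations `∑ z_i z_i* = 1` and `∑ z_i* z_i = 1`. -/
def complexRel (N : ℕ) : Set (FreeStarAlg N) :=
  {∑ i, z i * star (z i) - 1, ∑ i, star (z i) * z i - 1}

/-- The relations `x_i = x_i*` and `∑ x_i² = 1`. -/
def realRel (N : ℕ) : Set (FreeStarAlg N) :=
  {p | ∃ i, p = z i - star (z i)} ∪ {∑ i, z i ^ 2 - 1}

theorem toCompletion_sum (q : CStarSeminorm (FreeStarAlg N)) (f : Fin N → FreeStarAlg N) :
    q.toCompletion (∑ i, f i) = ∑ i, q.toCompletion (f i) :=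
  map_sum (AddMonoidHom.mk' q.toCompletion q.toCompletion_add) f Finset.univ

theorem toCompletion_eq (q : CStarSeminorm (FreeStarAlg N)) {a b : FreeStarAlg N}
    (h : q (a - b) = 0) : q.toCompletion a = q.toCompletion b := by
  rw [← sub_eq_zero, ← q.toCompletion_sub, ← norm_eq_zero, q.norm_toCompletion, h]

theorem one_le_one (q : CStarSeminorm (FreeStarAlg N)) : q 1 ≤ 1 := by
  have h := q.star_mul_self' 1
  rw [star_one, mul_one] at h
  nlinarith [q.nonneg 1]

/-- If `∑ z_i z_i* = 1` holds for a C*-seminorm, then the generators and their adjoints have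
seminorm at most one. -/
theorem letter_le_one (q : CStarSeminorm (FreeStarAlg N))
    (h : ∑ i, q.toCompletion (z i) * star (q.toCompletion (z i)) = 1) (i : Fin N) (e : Bool) :
    q (letter i e) ≤ 1 := by
  let _ : PartialOrder q.CStarCompletion := CStarAlgebra.spectralOrder _
  have _ : StarOrderedRing q.CStarCompletion := CStarAlgebra.spectralOrderedRing _
  have h1 : q.toCompletion (z i) * star (q.toCompletion (z i)) ≤ 1 := by
    rw [← h]
    exact Finset.single_le_sum (f := fun j => q.toCompletion (z j) * star (q.toCompletion (z j)))
      (fun j _ => mul_star_self_nonneg _) (Finset.mem_univ i)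
  have h2 := CStarAlgebra.norm_le_norm_of_nonneg_of_le (mul_star_self_nonneg _) h1
  rw [CStarRing.norm_self_mul_star, ← q.toCompletion_one, q.norm_toCompletion,
    q.norm_toCompletion] at h2
  have h3 := one_le_one q
  have hz : q (letter i false) ≤ 1 := by
    have : q (z i) ≤ 1 := by nlinarith [q.nonneg (z i)]
    exact this
  cases e
  · exact hz
  · have h4 := q.star_eq (letter i false)
    rw [star_letter] at h4
    exact h4.trans_le hz

theorem normBounding_of_letter_le_one {R : Set (FreeStarAlg N)}
    (h : ∀ q : CStarSeminorm (FreeStarAlg N), (∀ r ∈ R, q r = 0) → ∀ i e, q (letter i e) ≤ 1) :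
    NormBounding R := by
  intro a
  suffices H : ∃ C : ℝ, ∀ q : CStarSeminorm (FreeStarAlg N), (∀ r ∈ R, q r = 0) → q a ≤ C by
    obtain ⟨C, hC⟩ := H
    refine ⟨C, ?_⟩
    rintro _ ⟨q, hq, rfl⟩
    exact hC q hq
  refine FreeAlgebra.induction ℂ (Fin N × Bool)
    (motive := fun a : FreeStarAlg N => ∃ C : ℝ, ∀ q : CStarSeminorm (FreeStarAlg N),
      (∀ r ∈ R, q r = 0) → q a ≤ C) ?_ ?_ ?_ ?_ a
  · intro c
    refine ⟨‖c‖, fun q _ => ?_⟩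
    have h1 : q (c • (1 : FreeStarAlg N)) = ‖c‖ * q 1 := q.toSeminorm.smul' c 1
    have h2 : (algebraMap ℂ (FreeStarAlg N) c) = c • 1 := Algebra.algebraMap_eq_smul_one c
    refine (congrArg q h2).trans_le ?_
    rw [h1]
    exact mul_le_of_le_one_right (norm_nonneg c) (one_le_one q)
  · rintro ⟨i, e⟩
    exact ⟨1, fun q hq => h q hq i e⟩
  · rintro a b ⟨C, hC⟩ ⟨D, hD⟩
    exact ⟨C * D, fun q hq => (q.mul_le' a b).trans (mul_le_mul (hC q hq) (hD q hq)
      (q.nonneg b) ((q.nonneg a).trans (hC q hq)))⟩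
  · rintro a b ⟨C, hC⟩ ⟨D, hD⟩
    exact ⟨C + D, fun q hq => (map_add_le_add q.toSeminorm a b).trans
      (add_le_add (hC q hq) (hD q hq))⟩

theorem normBounding_complex (R : Set (FreeStarAlg N)) : NormBounding (complexRel N ∪ R) := by
  refine normBounding_of_letter_le_one fun q hq => letter_le_one q ?_
  have h := toCompletion_eq q (hq _ (Or.inl (Or.inl rfl)))
  simpa only [toCompletion_sum, q.toCompletion_mul, q.toCompletion_star, q.toCompletion_one] using h

theorem normBounding_real (R : Set (FreeStarAlg N)) : NormBounding (realRel N ∪ R) := by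
  refine normBounding_of_letter_le_one fun q hq => letter_le_one q ?_
  have h := toCompletion_eq q (hq _ (Or.inl (Or.inr rfl)))
  have hs : ∀ i : Fin N, q.toCompletion (z i) = star (q.toCompletion (z i)) := by
    intro i
    rw [← q.toCompletion_star]
    exact toCompletion_eq q (hq _ (Or.inl (Or.inl ⟨i, rfl⟩)))
  simpa only [toCompletion_sum, pow_two, q.toCompletion_mul, ← hs, q.toCompletion_one] using h

/-- The real noncommutative sphere with algebra
`C*(x_1, …, x_N | x_i = x_i*, ∑ x_i² = 1, and r = 0 for r ∈ R)`. -/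
def realSphere (R : Set (FreeStarAlg N)) : CoordSpace N :=
  CoordSpace.universal (realRel N ∪ R) (normBounding_real R)

/-- The complex noncommutative sphere with algebra
`C*(z_1, …, z_N | ∑ z_i z_i* = ∑ z_i* z_i = 1, and r = 0 for r ∈ R)`. -/
def complexSphere (R : Set (FreeStarAlg N)) : CoordSpace N :=
  CoordSpace.universal (complexRel N ∪ R) (normBounding_complex R)

/-- The classical real sphere, with its standard coordinate functions. -/
def real (N : ℕ) : CoordSpace N where
  fn := C(Metric.sphere (0 : EuclideanSpace ℝ (Fin N)) 1, ℂ)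
  coord i := ⟨fun x => ((x.1 i : ℝ) : ℂ), by fun_prop⟩

/-- The classical complex sphere, with its standard coordinate functions. -/
def complex (N : ℕ) : CoordSpace N where
  fn := C(Metric.sphere (0 : EuclideanSpace ℂ (Fin N)) 1, ℂ)
  coord i := ⟨fun x => x.1 i, by fun_prop⟩

/-- The free real sphere. -/
def realFree (N : ℕ) : CoordSpace N := realSphere ∅

/-- The free complex sphere. -/
def complexFree (N : ℕ) : CoordSpace N := complexSphere ∅

/-- The half-liberated real sphere: `abc = cba` for all `a, b, c` among the `x_i`. -/
def realHalf (N : ℕ) : CoordSpace N :=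
  realSphere {p | ∃ i j k, p = z i * z j * z k - z k * z j * z i}

/-- The half-liberated complex sphere: `abc = cba` for all `a, b, c` among the `z_i, z_i*`. -/
def complexHalf (N : ℕ) : CoordSpace N :=
  complexSphere {p | ∃ (i j k : Fin N) (e f g : Bool),
    p = letter i e * letter j f * letter k g - letter k g * letter j f * letter i e}

/-- The twisted real sphere: `ab = -ba` for all distinct `a, b` among the `x_i`. -/
def realTwist (N : ℕ) : CoordSpace N :=
  realSphere {p | ∃ i j, i ≠ j ∧ p = z i * z j + z j * z i}

/-- The twisted complex sphere: for `α = a, a*` and `β = b, b*` with `a, b` among the `z_i`, one has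
`αβ = -βα` if `a, b` are distinct, and `αβ = βα` otherwise. -/
def complexTwist (N : ℕ) : CoordSpace N :=
  complexSphere
    ({p | ∃ (i j : Fin N) (e f : Bool), i ≠ j ∧
        p = letter i e * letter j f + letter j f * letter i e} ∪
      {p | ∃ (i : Fin N) (e f : Bool), p = letter i e * letter i f - letter i f * letter i e})

/-- The half-liberated twisted real sphere: for `a, b, c` among the `x_i`, one has `abc = -cba` if
`a, b, c` are distinct, and `abc = cba` otherwise. -/
def realTwistHalf (N : ℕ) : CoordSpace N :=
  realSphere
    ({p | ∃ i j k, (i ≠ j ∧ j ≠ k ∧ i ≠ k) ∧ p = z i * z j * z k + z k * z j * z i} ∪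
      {p | ∃ i j k, ¬ (i ≠ j ∧ j ≠ k ∧ i ≠ k) ∧ p = z i * z j * z k - z k * z j * z i})

/-- The half-liberated twisted complex sphere: for `α = a, a*`, `β = b, b*` and `γ = c, c*` with
`a, b, c` among the `z_i`, one has `αβγ = -γβα` if `a, b, c` are distinct, and `αβγ = γβα`
otherwise. -/
def complexTwistHalf (N : ℕ) : CoordSpace N :=
  complexSphere
    ({p | ∃ (i j k : Fin N) (e f g : Bool), (i ≠ j ∧ j ≠ k ∧ i ≠ k) ∧
        p = letter i e * letter j f * letter k g + letter k g * letter j f * letter i e} ∪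
      {p | ∃ (i j k : Fin N) (e f g : Bool), ¬ (i ≠ j ∧ j ≠ k ∧ i ≠ k) ∧
        p = letter i e * letter j f * letter k g - letter k g * letter j f * letter i e})

end Sphere

end

/-! Except for the inclusion between the two classical spheres, the larger space of each inclusion
is given by a universal C*-algebra. A tuple in any C*-algebra that satisfies its relations receives
a coordinate-preserving `*`-homomorphism (`exists_hom_universal`), so an inclusion reduces to
checking that the coordinates of the smaller space satisfy the relations of the larger one.
Surjectivity holds because the `*`-polynomials in the coordinates are dense (by construction, or by
Stone–Weierstrass for a classical sphere), and a `*`-homomorphism of C*-algebras with dense range is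
onto (`StarAlgHom.surjective_of_denseRange`).

Properness is shown by a `*`-polynomial that vanishes on the smaller space and a concrete model of
the larger one where it does not vanish (`properSubspace_universal`). Scalars and `2 × 2` matrices
suffice. Normalised Pauli matrices X, Y half-commute without commuting, and X, Y, Z together do not
even half-commute. A unitary square root of Z, paired with X, violates `aab = baa`. The points
`(1,1,0,…)/√2` and `(1,1,1,0,…)/√3` violate the twisted and half-twisted relations, and `(i,0,…,0)`
separates the real spheres from the complex ones. The classical vertical inclusion is restriction of
functions to the real sphere.

For two self-adjoint coordinates, `x₁² = 1 - x₂²` commutes with `x₂`, and symmetrically. This gives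
all the half-commutation relations, while the sign rule for three distinct indices is vacuous. Hence
the three real algebras coincide. -/

noncomputable section

open scoped CStarAlgebra

/-! ### Star homomorphisms with dense range -/

section Surjective

variable {A B : Type*} [CStarAlgebra A] [CStarAlgebra B]

/-- A self-adjoint preimage is cut down by functional calculus with the clamp to `[-‖b‖, ‖b‖]`. A
`*`-homomorphism commutes with the calculus, and the clamp is the identity on the spectrum of `b`,
so the image does not change. -/
theorem StarAlgHom.exists_isSelfAdjoint_preimage_norm_le (φ : A →⋆ₐ[ℂ] B) {b : B}
    (hb : IsSelfAdjoint b) (hr : b ∈ Set.range φ) : ∃ a, φ a = b ∧ ‖a‖ ≤ ‖b‖ := by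
  obtain ⟨a₀, rfl⟩ := hr
  -- The real part of a preimage maps to the real part of `b`, which is `b` itself.
  obtain ⟨a, ha, hφ⟩ : ∃ a, IsSelfAdjoint a ∧ φ a = φ a₀ := by
    refine ⟨(realPart a₀ : A), (realPart a₀).2, ?_⟩
    rw [realPart_apply_coe, ← Complex.coe_smul, map_smul, map_add, map_star, hb.star_eq, ← two_smul ℂ,
      smul_smul]
    norm_num
  rw [← hφ] at hb ⊢
  set r := ‖φ a‖
  have hf : Continuous fun t : ℝ => max (-r) (min t r) := by fun_prop
  refine ⟨cfc (fun t : ℝ => max (-r) (min t r)) a, ?_, ?_⟩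
  · rw [φ.map_cfc _ a hf.continuousOn (map_continuous φ) ha hb]
    conv_rhs => rw [← cfc_id' ℝ (φ a)]
    refine cfc_congr fun t ht => ?_
    have h1 := norm_apply_le_norm_cfc (fun t : ℝ => t) (φ a) ht
    rw [cfc_id' ℝ (φ a), Real.norm_eq_abs, abs_le] at h1
    rw [min_eq_left h1.2, max_eq_right h1.1]
  · refine norm_cfc_le (norm_nonneg _) fun t _ => ?_
    have hr : 0 ≤ r := norm_nonneg _
    rw [Real.norm_eq_abs, abs_le]
    exact ⟨le_max_left _ _, max_le (by linarith) (min_le_right _ _)⟩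

/-- The real and imaginary parts are lifted separately, each without increase of norm. The factor 2
is harmless, since any uniform constant gives closed range. -/
theorem StarAlgHom.exists_preimage_norm_le (φ : A →⋆ₐ[ℂ] B) {b : B}
    (hr : b ∈ Set.range φ) : ∃ a, φ a = b ∧ ‖a‖ ≤ 2 * ‖b‖ := by
  obtain ⟨a₀, rfl⟩ := hr
  obtain ⟨x, hx, hxn⟩ := φ.exists_isSelfAdjoint_preimage_norm_le (realPart (φ a₀)).2
    ⟨realPart a₀, by simp [realPart_apply_coe, ← Complex.coe_smul, map_star]⟩
  obtain ⟨y, hy, hyn⟩ := φ.exists_isSelfAdjoint_preimage_norm_le (imaginaryPart (φ a₀)).2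
    ⟨imaginaryPart a₀, by simp [imaginaryPart_apply_coe, ← Complex.coe_smul, map_star]⟩
  refine ⟨x + Complex.I • y, ?_, ?_⟩
  · rw [map_add, map_smul, hx, hy, realPart_add_I_smul_imaginaryPart]
  · refine (norm_add_le _ _).trans ?_
    rw [norm_smul, Complex.norm_I, one_mul, two_mul]
    exact add_le_add (hxn.trans (realPart.norm_le (φ a₀))) (hyn.trans (imaginaryPart.norm_le (φ a₀)))

/-- A unital `*`-homomorphism of C*-algebras with dense range is surjective. -/
theorem StarAlgHom.surjective_of_denseRange (φ : A →⋆ₐ[ℂ] B) (h : DenseRange φ) :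
    Function.Surjective φ := by
  let f : NormedAddGroupHom A B :=
    (φ : A →+ B).mkNormedAddGroupHom 1 fun a =>
      (NonUnitalStarAlgHom.norm_apply_le φ a).trans_eq (one_mul _).symm
  have hf : f.SurjectiveOnWith f.range 2 := by
    rintro b ⟨a, rfl⟩
    exact φ.exists_preimage_norm_le ⟨a, rfl⟩
  intro b
  -- Norm-controlled lifting over the range extends to its closure because the domain is complete;
  -- by density that closure is everything.
  obtain ⟨a, ha, -⟩ := controlled_closure_of_complete two_pos one_pos hf b (h b)
  exact ⟨a, ha⟩

end Surjective

/-! ### Evaluation of noncommutative `*`-polynomials. -/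

namespace FreeStarAlg

variable {N : ℕ} {A B : Type*} [Ring A] [Algebra ℂ A] [StarRing A] [StarModule ℂ A]
  [Ring B] [Algebra ℂ B] [StarRing B]

/-- Evaluation of noncommutative `*`-polynomials, as a homomorphism of algebras. -/
def evalAlg (b : Fin N → B) : FreeStarAlg N →ₐ[ℂ] B :=
  FreeAlgebra.lift ℂ fun x : Fin N × Bool => bif x.2 then star (b x.1) else b x.1

theorem evalAlg_letter (b : Fin N → B) (i : Fin N) (e : Bool) :
    evalAlg b (letter i e) = bif e then star (b i) else b i :=
  FreeAlgebra.lift_ι_apply _ _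

theorem induction {p : FreeStarAlg N → Prop} (hc : ∀ c, p (algebraMap ℂ _ c))
    (hl : ∀ i e, p (letter i e)) (hm : ∀ a b, p a → p b → p (a * b))
    (ha : ∀ a b, p a → p b → p (a + b)) (a : FreeStarAlg N) : p a :=
  FreeAlgebra.induction ℂ (Fin N × Bool) (motive := p) hc (fun x => hl x.1 x.2) hm ha a

theorem hom_ext {f g : FreeStarAlg N →⋆ₐ[ℂ] B} (h : ∀ i, f (z i) = g (z i)) : f = g := by
  ext a
  induction a using FreeStarAlg.induction with
  | hc c => rw [AlgHomClass.commutes, AlgHomClass.commutes]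
  | hl i e =>
    cases e
    · exact h i
    · have : letter i true = star (z i) := (star_letter i false).symm
      rw [this, map_star, map_star, h]
  | hm a b ha hb => rw [map_mul, map_mul, ha, hb]
  | ha a b ha hb => rw [map_add, map_add, ha, hb]

variable [StarModule ℂ B]

/-- Evaluation of noncommutative `*`-polynomials. -/
def eval (b : Fin N → B) : FreeStarAlg N →⋆ₐ[ℂ] B where
  toAlgHom := evalAlg b
  map_star' a := by
    change evalAlg b (star a) = star (evalAlg b a)
    induction a using FreeStarAlg.induction with
    | hc c =>
      rw [Algebra.algebraMap_eq_smul_one, star_smul, star_one, map_smul, map_smul, map_one,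
        star_smul, star_one]
    | hl i e => cases e <;> simp [star_letter, evalAlg_letter]
    | hm a b ha hb => rw [star_mul, map_mul, map_mul, star_mul, ha, hb]
    | ha a b ha hb => rw [star_add, map_add, map_add, star_add, ha, hb]

theorem eval_letter (b : Fin N → B) (i : Fin N) (e : Bool) :
    eval b (letter i e) = bif e then star (b i) else b i :=
  evalAlg_letter b i e

@[simp]
theorem eval_letter_true (b : Fin N → B) (i : Fin N) : eval b (letter i true) = star (b i) :=
  eval_letter b i true

@[simp]
theorem eval_letter_false (b : Fin N → B) (i : Fin N) : eval b (letter i false) = b i :=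
  eval_letter b i false

@[simp]
theorem eval_z (b : Fin N → B) (i : Fin N) : eval b (z i) = b i :=
  eval_letter b i false

theorem map_eval (φ : A →⋆ₐ[ℂ] B) (a : Fin N → A) (p : FreeStarAlg N) :
    φ (eval a p) = eval (fun i => φ (a i)) p := by
  have : φ.comp (eval a) = eval (fun i => φ (a i)) := hom_ext fun i => by simp
  exact DFunLike.congr_fun this p

end FreeStarAlg

/-! ### The universal property -/

/-- The C*-seminorm pulled back along a homomorphism to a C*-algebra. -/
def CStarSeminorm.ofHom {P : Type} [Ring P] [Algebra ℂ P] [StarRing P] {B : Type*} [CStarAlgebra B]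
    (f : P →⋆ₐ[ℂ] B) : CStarSeminorm P where
  toSeminorm := (normSeminorm ℂ B).comp f.toAlgHom.toLinearMap
  mul_le' a b := by
    change ‖f (a * b)‖ ≤ ‖f a‖ * ‖f b‖
    rw [map_mul]
    exact norm_mul_le _ _
  star_mul_self' a := by
    change ‖f (star a * a)‖ = ‖f a‖ * ‖f a‖
    rw [map_mul, map_star]
    exact CStarRing.norm_star_mul_self

/-- The canonical map to the completion, as a `*`-homomorphism. -/
def CStarSeminorm.toCompletionHom {P : Type} [Ring P] [Algebra ℂ P] [StarRing P] [StarModule ℂ P]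
    (q : CStarSeminorm P) : P →⋆ₐ[ℂ] q.CStarCompletion where
  toFun := q.toCompletion
  map_one' := q.toCompletion_one
  map_mul' := q.toCompletion_mul
  map_zero' := by simpa using q.toCompletion_smul 0 0
  map_add' := q.toCompletion_add
  commutes' c := by
    rw [Algebra.algebraMap_eq_smul_one, Algebra.algebraMap_eq_smul_one, q.toCompletion_smul,
      q.toCompletion_one]
  map_star' := q.toCompletion_star

/-- Extension to the completion of a homomorphism dominated by the seminorm. -/
def CStarSeminorm.extend {P : Type} [Ring P] [Algebra ℂ P] [StarRing P] [StarModule ℂ P]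
    (q : CStarSeminorm P) {B : Type*} [CStarAlgebra B] (f : P →⋆ₐ[ℂ] B) (h : ∀ a, ‖f a‖ ≤ q a) :
    q.CStarCompletion →⋆ₐ[ℂ] B :=
  let g : q.Carrier →+* B := f.toAlgHom.toRingHom
  have hg : Continuous g := AddMonoidHomClass.continuous_of_bound g 1 fun a => by
    rw [one_mul]
    exact h a
  let F : q.CStarCompletion →+* B := UniformSpace.Completion.extensionHom g hg
  have hF : Continuous F := UniformSpace.Completion.continuous_extension
  have hFc : ∀ a, F (q.toCompletion a) = f a := fun a =>
    UniformSpace.Completion.extensionHom_coe g hg a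
  { F with
    commutes' := fun c => by
      change F _ = _
      rw [← AlgHomClass.commutes q.toCompletionHom c]
      exact (hFc _).trans (AlgHomClass.commutes f c)
    map_star' := fun x => by
      change F _ = star (F _)
      refine q.denseRange_toCompletion.induction_on x
        (isClosed_eq (hF.comp q.continuous_star') hF.star) fun a => ?_
      rw [← q.toCompletion_star, hFc, hFc, map_star] }

theorem CStarSeminorm.extend_toCompletion {P : Type} [Ring P] [Algebra ℂ P] [StarRing P]
    [StarModule ℂ P] (q : CStarSeminorm P) {B : Type*} [CStarAlgebra B] (f : P →⋆ₐ[ℂ] B)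
    (h : ∀ a, ‖f a‖ ≤ q a) (a : P) : q.extend f h (q.toCompletion a) = f a :=
  let g : q.Carrier →+* B := f.toAlgHom.toRingHom
  UniformSpace.Completion.extensionHom_coe g
    (AddMonoidHomClass.continuous_of_bound g 1 fun a => (h a).trans_eq (one_mul _).symm) a

namespace CoordSpace

open FreeStarAlg

variable {N : ℕ}

/-- The elements `b` of a C*-algebra satisfy the relations `R`. -/
def Satisfies {B : Type*} [CStarAlgebra B] (R : Set (FreeStarAlg N)) (b : Fin N → B) : Prop :=
  ∀ r ∈ R, eval b r = 0

theorem eval_universal (R : Set (FreeStarAlg N)) (hR : NormBounding R) (p : FreeStarAlg N) :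
    eval (universal R hR).coord p = (maxCStarSeminorm R hR).toCompletion p := by
  have : (eval (universal R hR).coord) = (maxCStarSeminorm R hR).toCompletionHom :=
    hom_ext fun i => by rw [eval_z]; rfl
  rw [this]
  rfl

/-- The norm of the image of a relation is a supremum over seminorms that all vanish on that
relation. -/
theorem satisfies_universal (R : Set (FreeStarAlg N)) (hR : NormBounding R) :
    Satisfies R (universal R hR).coord := by
  intro r hr
  rw [eval_universal]
  refine norm_eq_zero.mp ((CStarSeminorm.norm_toCompletion _ r).trans ?_)
  refine le_antisymm (csSup_le (seminormValues_nonempty R r) ?_) (sSup_seminormValues_nonneg R r)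
  rintro _ ⟨q, hq, rfl⟩
  exact (hq r hr).le

theorem denseRange_eval_universal (R : Set (FreeStarAlg N)) (hR : NormBounding R) :
    DenseRange (eval (universal R hR).coord) := by
  have : ⇑(eval (universal R hR).coord) = (maxCStarSeminorm R hR).toCompletion :=
    funext (eval_universal R hR)
  rw [this]
  exact CStarSeminorm.denseRange_toCompletion _

/-- The seminorm `a ↦ ‖eval b a‖` is among those whose supremum is the maximal one, so `eval b` is
dominated by it and extends to the completion. -/
theorem exists_hom_universal {R : Set (FreeStarAlg N)} (hR : NormBounding R) {B : Type*}
    [CStarAlgebra B] {b : Fin N → B} (hb : Satisfies R b) :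
    ∃ φ : (universal R hR).fn →⋆ₐ[ℂ] B, ∀ i, φ ((universal R hR).coord i) = b i := by
  refine ⟨(maxCStarSeminorm R hR).extend (eval b) fun a => ?_, fun i => ?_⟩
  · refine le_sSup_seminormValues hR (CStarSeminorm.ofHom (eval b)) (fun r hr => ?_) a
    change ‖eval b r‖ = 0
    rw [hb r hr, norm_zero]
  · exact (CStarSeminorm.extend_toCompletion _ _ _ _).trans (eval_z b i)

/-- A proper inclusion is detected by a polynomial which vanishes on the smaller space, but not on
some model `b` of the relations of the larger one. -/
theorem properSubspace_universal {X : CoordSpace N} {R : Set (FreeStarAlg N)} (hR : NormBounding R)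
    (hX : DenseRange (eval X.coord)) (hXR : Satisfies R X.coord) {p : FreeStarAlg N}
    (hp : eval X.coord p = 0) {B : Type*} [CStarAlgebra B] {b : Fin N → B} (hb : Satisfies R b)
    (hbp : eval b p ≠ 0) : X.ProperSubspace (universal R hR) := by
  obtain ⟨φ, hφ⟩ := exists_hom_universal hR hXR
  obtain ⟨ψ, hψ⟩ := exists_hom_universal hR hb
  have hφe : ∀ a, φ (eval (universal R hR).coord a) = eval X.coord a := fun a => by
    rw [map_eval, funext hφ]
  have hψe : ∀ a, ψ (eval (universal R hR).coord a) = eval b a := fun a => by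
    rw [map_eval, funext hψ]
  -- If `φ` were injective, `p` would already vanish in the universal algebra, hence in the model
  -- `b`.
  refine ⟨φ, hφ, φ.surjective_of_denseRange ?_, fun hinj => hbp ?_⟩
  · refine hX.mono ?_
    rintro _ ⟨a, rfl⟩
    exact ⟨_, hφe a⟩
  · have h0 : eval (universal R hR).coord p = 0 := hinj (by rw [hφe, hp, map_zero])
    rw [← hψe, h0, map_zero]

/-- Relations with the same models define the same space. -/
theorem same_universal {R R' : Set (FreeStarAlg N)} (hR : NormBounding R) (hR' : NormBounding R')
    (h : Satisfies R' (universal R hR).coord) (h' : Satisfies R (universal R' hR').coord) :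
    (universal R hR).Same (universal R' hR') := by
  obtain ⟨φ, hφ⟩ := exists_hom_universal hR' h
  obtain ⟨ψ, hψ⟩ := exists_hom_universal hR h'
  have hφe : ∀ a, φ (eval (universal R' hR').coord a) = eval (universal R hR).coord a := fun a => by
    rw [map_eval, funext hφ]
  have hψe : ∀ a, ψ (eval (universal R hR).coord a) = eval (universal R' hR').coord a := fun a => by
    rw [map_eval, funext hψ]
  -- Both composites fix every `*`-polynomial in the coordinates, and these are dense.
  refine ⟨StarAlgEquiv.ofStarAlgHom φ ψ ?_ ?_, hφ⟩
  · refine StarAlgHom.ext fun x => ?_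
    refine (denseRange_eval_universal R' hR').induction_on x
      (isClosed_eq (map_continuous _) continuous_id) fun a => ?_
    simp [hφe, hψe]
  · refine StarAlgHom.ext fun x => ?_
    refine (denseRange_eval_universal R hR).induction_on x
      (isClosed_eq (map_continuous _) continuous_id) fun a => ?_
    simp [hφe, hψe]

end CoordSpace

namespace Sphere

open FreeStarAlg CoordSpace

/-! ### The relations, for families in a C*-algebra -/

section Families

variable {ι κ B : Type*} [Ring B]

/-- `abc = cba` for all `a, b, c` in the family. -/
def HalfCommuting (c : ι → B) : Prop := ∀ x y t, c x * c y * c t - c t * c y * c x = 0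

/-- Members of the family with distinct indices anticommute, and those with equal ones commute. -/
def Twisted (idx : ι → κ) (c : ι → B) : Prop :=
  (∀ x y, idx x ≠ idx y → c x * c y + c y * c x = 0) ∧
    ∀ x y, idx x = idx y → c x * c y - c y * c x = 0

/-- `abc = -cba` for members of the family with distinct indices, and `abc = cba` otherwise. -/
def HalfTwisted (idx : ι → κ) (c : ι → B) : Prop :=
  (∀ x y t, (idx x ≠ idx y ∧ idx y ≠ idx t ∧ idx x ≠ idx t) →
      c x * c y * c t + c t * c y * c x = 0) ∧
    ∀ x y t, ¬ (idx x ≠ idx y ∧ idx y ≠ idx t ∧ idx x ≠ idx t) →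
      c x * c y * c t - c t * c y * c x = 0

/-- Used with `f = Prod.fst`: for self-adjoint coordinates, reindexing turns relations among the
`x_i` into relations among all the letters `x_i, x_i*`. The same holds for the two variants below.
-/
theorem HalfCommuting.comp {c : ι → B} (h : HalfCommuting c) {ι' : Type*} (f : ι' → ι) :
    HalfCommuting (c ∘ f) := fun _ _ _ => h _ _ _

theorem Twisted.comp {idx : ι → κ} {c : ι → B} (h : Twisted idx c) {ι' : Type*} (f : ι' → ι) :
    Twisted (idx ∘ f) (c ∘ f) := ⟨fun _ _ => h.1 _ _, fun _ _ => h.2 _ _⟩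

theorem HalfTwisted.comp {idx : ι → κ} {c : ι → B} (h : HalfTwisted idx c) {ι' : Type*}
    (f : ι' → ι) : HalfTwisted (idx ∘ f) (c ∘ f) :=
  ⟨fun _ _ _ => h.1 _ _ _, fun _ _ _ => h.2 _ _ _⟩

/-- Reversing `abc` to `cba` exchanges each of the three pairs once, with one sign for each pair of
distinct indices. There are three such pairs when all indices are distinct, and two or none
otherwise, so the sign is `-1` exactly in the first case. -/
theorem Twisted.halfTwisted {idx : ι → κ} {c : ι → B} (h : Twisted idx c) :
    HalfTwisted idx c := by
  have anti : ∀ x y, idx x ≠ idx y → c x * c y = -(c y * c x) := fun x y hxy =>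
    eq_neg_of_add_eq_zero_left (h.1 x y hxy)
  have comm : ∀ x y, idx x = idx y → c x * c y = c y * c x := fun x y hxy =>
    sub_eq_zero.mp (h.2 x y hxy)
  refine ⟨fun x y t ⟨hxy, hyt, hxt⟩ => ?_, fun x y t hd => ?_⟩
  · rw [anti x y hxy, neg_mul, mul_assoc, anti x t hxt, mul_neg, neg_neg, ← mul_assoc,
      anti y t hyt, neg_mul, neg_add_cancel]
  · rw [sub_eq_zero]
    by_cases hxy : idx x = idx y
    · by_cases hyt : idx y = idx t
      · rw [comm x y hxy, mul_assoc, comm x t (hxy.trans hyt), ← mul_assoc, comm y t hyt]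
      · rw [comm x y hxy, mul_assoc, anti x t (hxy ▸ hyt), mul_neg, ← mul_assoc, anti y t hyt,
          neg_mul, neg_neg]
    · by_cases hyt : idx y = idx t
      · rw [anti x y hxy, neg_mul, mul_assoc, anti x t (hyt ▸ hxy), mul_neg, neg_neg, ← mul_assoc,
          comm y t hyt]
      · have hxt : idx x = idx t := by
          by_contra hxt
          exact hd ⟨hxy, hyt, hxt⟩
        rw [anti x y hxy, neg_mul, mul_assoc, comm x t hxt, ← mul_assoc, anti y t hyt, neg_mul,
          neg_neg]

theorem halfCommuting_of_comm {B : Type*} [CommRing B] (c : ι → B) : HalfCommuting c :=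
  fun _ _ _ => by ring

end Families

/-! ### Translation of the defining relations into conditions on tuples. -/

variable {N : ℕ} {B : Type*} [CStarAlgebra B]

/-- The values of the letters `z_i`, `z_i*` at the tuple `b`. -/
def letterValue (b : Fin N → B) (x : Fin N × Bool) : B := eval b (letter x.1 x.2)

theorem letterValue_of_star_eq {b : Fin N → B} (hb : ∀ i, star (b i) = b i) :
    letterValue b = b ∘ Prod.fst := by
  funext ⟨i, e⟩
  cases e <;> simp [letterValue, hb]

/-- The relations of the half-liberated real sphere, without those of the free one. -/
def realHalfRel (N : ℕ) : Set (FreeStarAlg N) :=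
  {p | ∃ i j k, p = z i * z j * z k - z k * z j * z i}

/-- The relations of the half-liberated complex sphere, without those of the free one. -/
def complexHalfRel (N : ℕ) : Set (FreeStarAlg N) :=
  {p | ∃ (i j k : Fin N) (e f g : Bool),
    p = letter i e * letter j f * letter k g - letter k g * letter j f * letter i e}

/-- The relations of the twisted real sphere, without those of the free one. -/
def realTwistRel (N : ℕ) : Set (FreeStarAlg N) :=
  {p | ∃ i j, i ≠ j ∧ p = z i * z j + z j * z i}

/-- The relations of the twisted complex sphere, without those of the free one. -/
def complexTwistRel (N : ℕ) : Set (FreeStarAlg N) :=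
  {p | ∃ (i j : Fin N) (e f : Bool), i ≠ j ∧
      p = letter i e * letter j f + letter j f * letter i e} ∪
    {p | ∃ (i : Fin N) (e f : Bool), p = letter i e * letter i f - letter i f * letter i e}

/-- The relations of the half-liberated twisted real sphere, without those of the free one. -/
def realTwistHalfRel (N : ℕ) : Set (FreeStarAlg N) :=
  {p | ∃ i j k, (i ≠ j ∧ j ≠ k ∧ i ≠ k) ∧ p = z i * z j * z k + z k * z j * z i} ∪
    {p | ∃ i j k, ¬ (i ≠ j ∧ j ≠ k ∧ i ≠ k) ∧ p = z i * z j * z k - z k * z j * z i}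

/-- The relations of the half-liberated twisted complex sphere, without those of the free one. -/
def complexTwistHalfRel (N : ℕ) : Set (FreeStarAlg N) :=
  {p | ∃ (i j k : Fin N) (e f g : Bool), (i ≠ j ∧ j ≠ k ∧ i ≠ k) ∧
      p = letter i e * letter j f * letter k g + letter k g * letter j f * letter i e} ∪
    {p | ∃ (i j k : Fin N) (e f g : Bool), ¬ (i ≠ j ∧ j ≠ k ∧ i ≠ k) ∧
      p = letter i e * letter j f * letter k g - letter k g * letter j f * letter i e}

theorem satisfies_union {R R' : Set (FreeStarAlg N)} {b : Fin N → B} :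
    Satisfies (R ∪ R') b ↔ Satisfies R b ∧ Satisfies R' b :=
  ⟨fun h => ⟨fun r hr => h r (Or.inl hr), fun r hr => h r (Or.inr hr)⟩,
    fun h r hr => hr.elim (h.1 r) (h.2 r)⟩

theorem satisfies_empty (b : Fin N → B) : Satisfies ∅ b := fun _ hr => hr.elim

theorem satisfies_realRel {b : Fin N → B} :
    Satisfies (realRel N) b ↔ (∀ i, star (b i) = b i) ∧ ∑ i, b i ^ 2 = 1 := by
  refine ⟨fun h => ⟨fun i => ?_, ?_⟩, ?_⟩
  · have := h _ (Or.inl ⟨i, rfl⟩)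
    rw [map_sub, map_star, eval_z, sub_eq_zero] at this
    exact this.symm
  · have := h _ (Or.inr rfl)
    simpa [sub_eq_zero] using this
  · rintro ⟨h1, h2⟩ r (⟨i, rfl⟩ | rfl)
    · rw [map_sub, map_star, eval_z, h1, sub_self]
    · simp [h2]

theorem satisfies_complexRel {b : Fin N → B} :
    Satisfies (complexRel N) b ↔ ∑ i, b i * star (b i) = 1 ∧ ∑ i, star (b i) * b i = 1 := by
  refine ⟨fun h => ⟨?_, ?_⟩, ?_⟩
  · simpa [sub_eq_zero, map_star] using h _ (Or.inl rfl)
  · simpa [sub_eq_zero, map_star] using h _ (Or.inr rfl)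
  · rintro ⟨h1, h2⟩ r (rfl | rfl)
    · simp [h1, map_star]
    · simp [h2, map_star]

theorem satisfies_complexRel_of_realRel {b : Fin N → B} (h : Satisfies (realRel N) b) :
    Satisfies (complexRel N) b := by
  obtain ⟨h1, h2⟩ := satisfies_realRel.mp h
  simp only [satisfies_complexRel, h1, ← pow_two, h2, and_self]

theorem satisfies_realHalfRel {b : Fin N → B} :
    Satisfies (realHalfRel N) b ↔ HalfCommuting b := by
  constructor
  · intro h i j k
    simpa using h _ ⟨i, j, k, rfl⟩
  · rintro h _ ⟨i, j, k, rfl⟩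
    simpa using h i j k

theorem satisfies_complexHalfRel {b : Fin N → B} :
    Satisfies (complexHalfRel N) b ↔ HalfCommuting (letterValue b) := by
  constructor
  · rintro h ⟨i, e⟩ ⟨j, f⟩ ⟨k, g⟩
    simpa only [letterValue, map_sub, map_mul] using h _ ⟨i, j, k, e, f, g, rfl⟩
  · rintro h _ ⟨i, j, k, e, f, g, rfl⟩
    simpa only [letterValue, map_sub, map_mul] using h (i, e) (j, f) (k, g)

theorem satisfies_realTwistRel {b : Fin N → B} :
    Satisfies (realTwistRel N) b ↔ Twisted id b := by
  constructor
  · intro h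
    refine ⟨fun i j hij => by simpa using h _ ⟨i, j, hij, rfl⟩, ?_⟩
    -- With `id` as index map, equal indices mean equal elements, so the commutation clause is
    -- trivial.
    rintro i _ rfl
    exact sub_self _
  · rintro h _ ⟨i, j, hij, rfl⟩
    simpa using h.1 i j hij

theorem satisfies_complexTwistRel {b : Fin N → B} :
    Satisfies (complexTwistRel N) b ↔ Twisted Prod.fst (letterValue b) := by
  constructor
  · intro h
    refine ⟨?_, ?_⟩
    · rintro ⟨i, e⟩ ⟨j, f⟩ hij
      simpa only [letterValue, map_add, map_mul] using h _ (Or.inl ⟨i, j, e, f, hij, rfl⟩)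
    · rintro ⟨i, e⟩ ⟨_, f⟩ rfl
      simpa only [letterValue, map_sub, map_mul] using h _ (Or.inr ⟨i, e, f, rfl⟩)
  · rintro h _ (⟨i, j, e, f, hij, rfl⟩ | ⟨i, e, f, rfl⟩)
    · simpa only [letterValue, map_add, map_mul] using h.1 (i, e) (j, f) hij
    · simpa only [letterValue, map_sub, map_mul] using h.2 (i, e) (i, f) rfl

theorem satisfies_realTwistHalfRel {b : Fin N → B} :
    Satisfies (realTwistHalfRel N) b ↔ HalfTwisted id b := by
  constructor
  · intro h
    exact ⟨fun i j k hd => by simpa using h _ (Or.inl ⟨i, j, k, hd, rfl⟩),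
      fun i j k hd => by simpa using h _ (Or.inr ⟨i, j, k, hd, rfl⟩)⟩
  · rintro h _ (⟨i, j, k, hd, rfl⟩ | ⟨i, j, k, hd, rfl⟩)
    · simpa using h.1 i j k hd
    · simpa using h.2 i j k hd

theorem satisfies_complexTwistHalfRel {b : Fin N → B} :
    Satisfies (complexTwistHalfRel N) b ↔ HalfTwisted Prod.fst (letterValue b) := by
  constructor
  · intro h
    refine ⟨?_, ?_⟩
    · rintro ⟨i, e⟩ ⟨j, f⟩ ⟨k, g⟩ hd
      simpa only [letterValue, map_add, map_mul] using h _ (Or.inl ⟨i, j, k, e, f, g, hd, rfl⟩)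
    · rintro ⟨i, e⟩ ⟨j, f⟩ ⟨k, g⟩ hd
      simpa only [letterValue, map_sub, map_mul] using h _ (Or.inr ⟨i, j, k, e, f, g, hd, rfl⟩)
  · rintro h _ (⟨i, j, k, e, f, g, hd, rfl⟩ | ⟨i, j, k, e, f, g, hd, rfl⟩)
    · simpa only [letterValue, map_add, map_mul] using h.1 (i, e) (j, f) (k, g) hd
    · simpa only [letterValue, map_sub, map_mul] using h.2 (i, e) (j, f) (k, g) hd

/-! ### The classical spheres -/

/-- Stone–Weierstrass: the range of evaluation is a unital `*`-subalgebra that contains the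
functions `f i`, and these separate points. -/
theorem denseRange_eval_continuousMap {K : Type} [TopologicalSpace K] [CompactSpace K]
    {f : Fin N → C(K, ℂ)} (hf : ∀ x y, (∀ i, f i x = f i y) → x = y) : DenseRange (eval f) := by
  have h := ContinuousMap.starSubalgebra_topologicalClosure_eq_top_of_separatesPoints
    (eval f).range (by
      intro x y hxy
      by_contra! H
      refine hxy (hf x y fun i => H (f i) ⟨f i, ⟨z i, eval_z f i⟩, rfl⟩))
  intro g
  have hg : g ∈ (eval f).range.topologicalClosure := h ▸ StarSubalgebra.mem_top
  exact hg

theorem denseRange_eval_real (N : ℕ) : DenseRange (eval (real N).coord) := by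
  refine denseRange_eval_continuousMap fun x y h => Subtype.ext (PiLp.ext fun i => ?_)
  exact Complex.ofReal_injective (h i)

theorem denseRange_eval_complex (N : ℕ) : DenseRange (eval (complex N).coord) :=
  denseRange_eval_continuousMap fun _ _ h => Subtype.ext (PiLp.ext h)

theorem satisfies_real (N : ℕ) : Satisfies (realRel N) (real N).coord := by
  refine satisfies_realRel.mpr ⟨fun i => ?_, ?_⟩
  · exact ContinuousMap.ext fun x => Complex.conj_ofReal _
  · refine ContinuousMap.ext fun x => ?_
    have hx := EuclideanSpace.norm_sq_eq x.1
    rw [norm_eq_of_mem_sphere x, one_pow] at hx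
    refine (ContinuousMap.sum_apply _ _ x).trans ?_
    change ∑ i, ((x.1 i : ℝ) : ℂ) ^ 2 = 1
    have := congrArg Complex.ofReal hx
    simpa using this.symm

theorem satisfies_complex (N : ℕ) : Satisfies (complexRel N) (complex N).coord := by
  have key : ∑ i, (complex N).coord i * star ((complex N).coord i) = 1 := by
    refine ContinuousMap.ext fun x => ?_
    have hx := EuclideanSpace.norm_sq_eq x.1
    rw [norm_eq_of_mem_sphere x, one_pow] at hx
    refine (ContinuousMap.sum_apply _ _ x).trans ?_
    change ∑ i, x.1 i * starRingEnd ℂ (x.1 i) = 1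
    have := congrArg Complex.ofReal hx
    simpa [Complex.mul_conj, Complex.normSq_eq_norm_sq] using this.symm
  refine satisfies_complexRel.mpr ⟨key, ?_⟩
  rw [← key]
  exact Finset.sum_congr rfl fun i _ => mul_comm (G := C(_, ℂ)) _ _


/-! ### Models with at most three nonzero coordinates -/

section Tuple

variable {N : ℕ} {B : Type*} [Ring B]

/-- The tuple `(u, v, w, 0, …, 0)`, cut to its first `N` entries. -/
def tuple (N : ℕ) (u v w : B) (i : Fin N) : B :=
  match (i : ℕ) with
  | 0 => u
  | 1 => v
  | 2 => w
  | _ => 0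

theorem tuple_pair_cases (u v : B) (i : Fin N) :
    ((i : ℕ) = 0 ∧ tuple N u v 0 i = u) ∨ ((i : ℕ) = 1 ∧ tuple N u v 0 i = v) ∨
      (2 ≤ (i : ℕ) ∧ tuple N u v 0 i = 0) := by
  obtain ⟨_ | _ | _ | i, hi⟩ := i <;> simp [tuple]

/-- The second alternative covers `N = 2`, where the third entry is cut off and must therefore be
zero. The condition `f 0 = 0` removes the tail. -/
theorem sum_tuple {u v w : B} (hN : 3 ≤ N ∨ 2 ≤ N ∧ w = 0) (f : B → B) (hf : f 0 = 0) :
    ∑ i, f (tuple N u v w i) = f u + f v + f w := by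
  by_cases h3 : 3 ≤ N
  · obtain ⟨n, rfl⟩ := Nat.exists_eq_add_of_le' h3
    simp [Fin.sum_univ_succ, tuple, hf, add_assoc]
  · obtain ⟨h2, rfl⟩ := hN.resolve_left h3
    obtain rfl : N = 2 := by omega
    simp [Fin.sum_univ_two, tuple, hf]

/-- Among three distinct indices, one carries a zero entry, so the sign rule is vacuous. In the
remaining triples the only words in `u, v` that are not palindromes are `uuv`, `vvu` and their
reversals, which the two hypotheses handle. -/
theorem halfTwisted_tuple {u v : B} (huv : u * u * v = v * u * u) (hvu : v * v * u = u * v * v) :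
    HalfTwisted id (tuple N u v 0) := by
  refine ⟨fun i j k hd => ?_, fun i j k _ => ?_⟩
  · have hd' : (i : ℕ) ≠ j ∧ (j : ℕ) ≠ k ∧ (i : ℕ) ≠ k := by simpa [Fin.ext_iff] using hd
    rcases tuple_pair_cases u v i with ⟨hi, hi'⟩ | ⟨hi, hi'⟩ | ⟨hi, hi'⟩ <;>
      rcases tuple_pair_cases u v j with ⟨hj, hj'⟩ | ⟨hj, hj'⟩ | ⟨hj, hj'⟩ <;>
      rcases tuple_pair_cases u v k with ⟨hk, hk'⟩ | ⟨hk, hk'⟩ | ⟨hk, hk'⟩ <;>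
      first | omega | simp [hi', hj', hk']
  · rcases tuple_pair_cases u v i with ⟨-, hi⟩ | ⟨-, hi⟩ | ⟨-, hi⟩ <;>
      rcases tuple_pair_cases u v j with ⟨-, hj⟩ | ⟨-, hj⟩ | ⟨-, hj⟩ <;>
      rcases tuple_pair_cases u v k with ⟨-, hk⟩ | ⟨-, hk⟩ | ⟨-, hk⟩ <;>
      simp [hi, hj, hk, huv, hvu]

theorem halfCommuting_tuple {u v : B} (huv : u * u * v = v * u * u) (hvu : v * v * u = u * v * v) :
    HalfCommuting (tuple N u v 0) := by
  intro i j k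
  rcases tuple_pair_cases u v i with ⟨-, hi⟩ | ⟨-, hi⟩ | ⟨-, hi⟩ <;>
    rcases tuple_pair_cases u v j with ⟨-, hj⟩ | ⟨-, hj⟩ | ⟨-, hj⟩ <;>
    rcases tuple_pair_cases u v k with ⟨-, hk⟩ | ⟨-, hk⟩ | ⟨-, hk⟩ <;>
    simp [hi, hj, hk, huv, hvu]

theorem star_tuple [StarRing B] {u v w : B} (hu : star u = u) (hv : star v = v) (hw : star w = w)
    (i : Fin N) : star (tuple N u v w i) = tuple N u v w i := by
  obtain ⟨_ | _ | _ | i, hi⟩ := i <;> simp [tuple, hu, hv, hw]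

end Tuple

theorem satisfies_realRel_tuple {N : ℕ} {B : Type*} [CStarAlgebra B] {u v w : B}
    (hN : 3 ≤ N ∨ 2 ≤ N ∧ w = 0) (hu : star u = u) (hv : star v = v) (hw : star w = w)
    (h : u * u + v * v + w * w = 1) : Satisfies (realRel N) (tuple N u v w) := by
  refine satisfies_realRel.mpr ⟨star_tuple hu hv hw, ?_⟩
  rw [sum_tuple hN (fun x => x ^ 2) (by simp), pow_two, pow_two, pow_two, h]

/-! ### The Pauli matrices -/

section Pauli

open scoped ComplexOrder

/-- The algebra of `2 × 2` complex matrices, as a C*-algebra. -/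
abbrev MatTwo : Type := CStarMatrix (Fin 2) (Fin 2) ℂ

/-- The first Pauli matrix. -/
def pauliX : MatTwo := CStarMatrix.ofMatrix !![0, 1; 1, 0]

/-- The second Pauli matrix. -/
def pauliY : MatTwo := CStarMatrix.ofMatrix !![0, -Complex.I; Complex.I, 0]

/-- The third Pauli matrix. -/
def pauliZ : MatTwo := CStarMatrix.ofMatrix !![1, 0; 0, -1]

/-- A diagonal unitary whose square is the third Pauli matrix. -/
def phase : MatTwo := CStarMatrix.ofMatrix !![1, 0; 0, Complex.I]

theorem star_pauliX : star pauliX = pauliX := by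
  ext i j
  fin_cases i <;> fin_cases j <;> simp [pauliX, CStarMatrix.star_apply]

theorem star_pauliY : star pauliY = pauliY := by
  ext i j
  fin_cases i <;> fin_cases j <;> simp [pauliY, CStarMatrix.star_apply]

theorem star_pauliZ : star pauliZ = pauliZ := by
  ext i j
  fin_cases i <;> fin_cases j <;> simp [pauliZ, CStarMatrix.star_apply]

theorem pauliX_mul_self : pauliX * pauliX = 1 := by
  ext i j
  fin_cases i <;> fin_cases j <;> simp [pauliX, CStarMatrix.mul_apply]

theorem pauliY_mul_self : pauliY * pauliY = 1 := by
  ext i j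
  fin_cases i <;> fin_cases j <;> simp [pauliY, CStarMatrix.mul_apply]

theorem pauliZ_mul_self : pauliZ * pauliZ = 1 := by
  ext i j
  fin_cases i <;> fin_cases j <;> simp [pauliZ, CStarMatrix.mul_apply]

theorem pauliX_mul_pauliY : pauliX * pauliY = Complex.I • pauliZ := by
  ext i j
  fin_cases i <;> fin_cases j <;> simp [pauliX, pauliY, pauliZ, CStarMatrix.mul_apply]

theorem pauliY_mul_pauliX : pauliY * pauliX = -(Complex.I • pauliZ) := by
  ext i j
  fin_cases i <;> fin_cases j <;> simp [pauliX, pauliY, pauliZ, CStarMatrix.mul_apply]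

theorem pauliX_mul_pauliZ : pauliX * pauliZ = -(pauliZ * pauliX) := by
  ext i j
  fin_cases i <;> fin_cases j <;> simp [pauliX, pauliZ, CStarMatrix.mul_apply]

theorem phase_mul_self : phase * phase = pauliZ := by
  ext i j
  fin_cases i <;> fin_cases j <;> simp [phase, pauliZ, CStarMatrix.mul_apply]

theorem star_phase_mul_self : star phase * phase = 1 := by
  ext i j
  fin_cases i <;> fin_cases j <;>
    simp [phase, CStarMatrix.mul_apply, CStarMatrix.star_apply]

theorem phase_mul_star_self : phase * star phase = 1 := by
  ext i j
  fin_cases i <;> fin_cases j <;>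
    simp [phase, CStarMatrix.mul_apply, CStarMatrix.star_apply]

theorem pauliZ_ne_zero : pauliZ ≠ 0 := fun h => by
  simpa [pauliZ] using congrFun (congrFun h 0) 0

end Pauli

/-- The scalar `1/√(n+1)` normalises `n + 1` coordinates whose squares are 1; it is used with `n =
1` for two coordinates and `n = 2` for three. -/
theorem exists_real_scalar (n : ℕ) : ∃ r : ℂ, star r = r ∧ r ≠ 0 ∧ r * r = ((n : ℂ) + 1)⁻¹ := by
  have hn : (0 : ℝ) < (n + 1 : ℝ)⁻¹ := by positivity
  refine ⟨(Real.sqrt ((n + 1 : ℝ)⁻¹) : ℝ), Complex.conj_ofReal _, ?_, ?_⟩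
  · exact Complex.ofReal_ne_zero.mpr (Real.sqrt_pos.mpr hn).ne'
  · rw [← Complex.ofReal_mul, Real.mul_self_sqrt hn.le]
    push_cast
    rfl

open scoped ComplexOrder

/-! ### Models of the relations -/

variable {N : ℕ}

/-- The first coordinate. -/
def idx₀ (hN : 2 ≤ N) : Fin N := ⟨0, by omega⟩

/-- The second coordinate. -/
def idx₁ (hN : 2 ≤ N) : Fin N := ⟨1, by omega⟩

/-- The third coordinate. -/
def idx₂ (hN : 3 ≤ N) : Fin N := ⟨2, by omega⟩

/-- The squares of X and Y are scalar, which gives half-commutation, while `XY = iZ = -YX`. -/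
theorem exists_halfCommuting_not_commuting (hN : 2 ≤ N) : ∃ b : Fin N → MatTwo,
    Satisfies (realRel N) b ∧ HalfCommuting b ∧
      eval b (z (idx₀ hN) * z (idx₁ hN) - z (idx₁ hN) * z (idx₀ hN)) ≠ 0 := by
  obtain ⟨r, hr, hr0, hrr⟩ := exists_real_scalar 1
  refine ⟨tuple N (r • pauliX) (r • pauliY) 0, ?_, ?_, ?_⟩
  · refine satisfies_realRel_tuple (Or.inr ⟨hN, rfl⟩) ?_ ?_ (star_zero _) ?_
    · rw [star_smul, hr, star_pauliX]
    · rw [star_smul, hr, star_pauliY]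
    · rw [smul_mul_smul_comm, smul_mul_smul_comm, pauliX_mul_self, pauliY_mul_self, hrr,
        mul_zero, add_zero, ← add_smul]
      norm_num
  · refine halfCommuting_tuple ?_ ?_
    · simp only [smul_mul_smul_comm, pauliX_mul_self, mul_assoc, one_mul, mul_one]
    · simp only [smul_mul_smul_comm, pauliY_mul_self, mul_assoc, one_mul, mul_one]
  · rw [map_sub, map_mul, map_mul, eval_z, eval_z]
    change (r • pauliX) * (r • pauliY) - (r • pauliY) * (r • pauliX) ≠ 0
    rw [smul_mul_smul_comm, smul_mul_smul_comm, pauliX_mul_pauliY, pauliY_mul_pauliX, smul_neg,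
      sub_neg_eq_add, ← two_smul ℂ]
    simp [hr0, pauliZ_ne_zero]

/-- A self-adjoint model is impossible when `N = 2`, so a unitary that is not self-adjoint is used:
its square Z anticommutes with X. The word `aab` has a repeated index, so the same model violates
both the half-liberated and the half-liberated twisted relations. -/
theorem exists_not_halfCommuting (hN : 2 ≤ N) : ∃ b : Fin N → MatTwo,
    Satisfies (complexRel N) b ∧
      eval b (z (idx₀ hN) * z (idx₀ hN) * z (idx₁ hN) -
        z (idx₁ hN) * z (idx₀ hN) * z (idx₀ hN)) ≠ 0 := by
  obtain ⟨r, hr, hr0, hrr⟩ := exists_real_scalar 1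
  refine ⟨tuple N (r • phase) (r • pauliX) 0, ?_, ?_⟩
  · refine satisfies_complexRel.mpr ⟨?_, ?_⟩
    · rw [sum_tuple (Or.inr ⟨hN, rfl⟩) (fun x => x * star x) (by simp), star_smul, star_smul, hr,
        smul_mul_smul_comm, smul_mul_smul_comm, star_pauliX, pauliX_mul_self, phase_mul_star_self,
        hrr, zero_mul, add_zero, ← add_smul]
      norm_num
    · rw [sum_tuple (Or.inr ⟨hN, rfl⟩) (fun x => star x * x) (by simp), star_smul, star_smul, hr,
        smul_mul_smul_comm, smul_mul_smul_comm, star_pauliX, pauliX_mul_self, star_phase_mul_self,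
        hrr, mul_zero, add_zero, ← add_smul]
      norm_num
  · rw [map_sub, map_mul, map_mul, map_mul, map_mul, eval_z, eval_z]
    change (r • phase) * (r • phase) * (r • pauliX) - (r • pauliX) * (r • phase) * (r • phase) ≠ 0
    rw [mul_assoc (r • pauliX), smul_mul_smul_comm r phase, phase_mul_self, smul_mul_smul_comm,
      smul_mul_smul_comm, pauliX_mul_pauliZ, smul_neg, sub_neg_eq_add, mul_assoc r r r, ← two_smul ℂ,
      smul_smul]
    -- What remains is a nonzero multiple of `ZX`, and X is invertible, being its own inverse.
    refine smul_ne_zero (by simp [hr0]) fun h => pauliZ_ne_zero ?_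
    rw [← mul_one pauliZ, ← pauliX_mul_self, ← mul_assoc, h, zero_mul]

/-- Commuting scalars with only two nonzero entries satisfy the half-twisted relations, but their
anticommutator is `2r² ≠ 0`. -/
theorem exists_halfTwisted_not_twisted (hN : 2 ≤ N) : ∃ b : Fin N → ℂ,
    Satisfies (realRel N) b ∧ HalfTwisted id b ∧
      eval b (z (idx₀ hN) * z (idx₁ hN) + z (idx₁ hN) * z (idx₀ hN)) ≠ 0 := by
  obtain ⟨r, hr, hr0, hrr⟩ := exists_real_scalar 1
  refine ⟨tuple N r r 0, ?_, halfTwisted_tuple rfl rfl, ?_⟩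
  · refine satisfies_realRel_tuple (Or.inr ⟨hN, rfl⟩) hr hr (star_zero _) ?_
    rw [hrr]
    norm_num
  · rw [map_add, map_mul, map_mul, eval_z, eval_z]
    change r * r + r * r ≠ 0
    simp [← two_mul, hr0]

/-- The three Pauli matrices satisfy `XYZ = i` and `ZYX = -i`. -/
theorem exists_real_not_halfCommuting (hN : 3 ≤ N) : ∃ b : Fin N → MatTwo,
    Satisfies (realRel N) b ∧
      eval b (z (idx₀ (by omega)) * z (idx₁ (by omega)) * z (idx₂ hN) -
        z (idx₂ hN) * z (idx₁ (by omega)) * z (idx₀ (by omega))) ≠ 0 := by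
  obtain ⟨r, hr, hr0, hrr⟩ := exists_real_scalar 2
  refine ⟨tuple N (r • pauliX) (r • pauliY) (r • pauliZ), ?_, ?_⟩
  · refine satisfies_realRel_tuple (Or.inl hN) ?_ ?_ ?_ ?_
    · rw [star_smul, hr, star_pauliX]
    · rw [star_smul, hr, star_pauliY]
    · rw [star_smul, hr, star_pauliZ]
    · rw [smul_mul_smul_comm, smul_mul_smul_comm, smul_mul_smul_comm, pauliX_mul_self,
        pauliY_mul_self, pauliZ_mul_self, hrr, ← add_smul, ← add_smul]
      norm_num
  · rw [map_sub, map_mul, map_mul, map_mul, map_mul, eval_z, eval_z, eval_z]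
    change (r • pauliX) * (r • pauliY) * (r • pauliZ) -
      (r • pauliZ) * (r • pauliY) * (r • pauliX) ≠ 0
    rw [mul_assoc (r • pauliZ), smul_mul_smul_comm r pauliX, smul_mul_smul_comm r pauliY,
      pauliX_mul_pauliY, pauliY_mul_pauliX, smul_mul_smul_comm, smul_mul_smul_comm, mul_neg,
      smul_mul_assoc, mul_smul_comm, pauliZ_mul_self, smul_neg, sub_neg_eq_add, mul_assoc r r r,
      ← two_smul ℂ]
    simp [hr0]

/-- At the classical point `(1,1,1,0,…)/√3` both reversed products agree and are nonzero, so they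
are not opposite. -/
theorem exists_real_not_halfTwisted (hN : 3 ≤ N) : ∃ b : Fin N → ℂ,
    Satisfies (realRel N) b ∧
      eval b (z (idx₀ (by omega)) * z (idx₁ (by omega)) * z (idx₂ hN) +
        z (idx₂ hN) * z (idx₁ (by omega)) * z (idx₀ (by omega))) ≠ 0 := by
  obtain ⟨r, hr, hr0, hrr⟩ := exists_real_scalar 2
  refine ⟨tuple N r r r, ?_, ?_⟩
  · refine satisfies_realRel_tuple (Or.inl hN) hr hr hr ?_
    rw [hrr]
    norm_num
  · rw [map_add, map_mul, map_mul, map_mul, map_mul, eval_z, eval_z, eval_z]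
    change r * r * r + r * r * r ≠ 0
    simp [← two_mul, hr0]

/-- In the point `(i,0,…,0)` products of letters with distinct indices vanish and all scalars
commute. It is therefore a model of every complex sphere here, twisted or not, and separates each
one from its real counterpart. -/
theorem exists_not_selfAdjoint (hN : 2 ≤ N) : ∃ b : Fin N → ℂ,
    Satisfies (complexRel N) b ∧ Twisted Prod.fst (letterValue b) ∧
      eval b (z (idx₀ hN) - star (z (idx₀ hN))) ≠ 0 := by
  refine ⟨tuple N Complex.I 0 0, ?_, ⟨?_, fun x y _ => by ring⟩, ?_⟩
  · refine satisfies_complexRel.mpr ⟨?_, ?_⟩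
    · rw [sum_tuple (Or.inr ⟨hN, rfl⟩) (fun x => x * star x) (by simp)]
      simp
    · rw [sum_tuple (Or.inr ⟨hN, rfl⟩) (fun x => star x * x) (by simp)]
      simp
  · have h0 : ∀ i : Fin N, (i : ℕ) ≠ 0 → tuple N Complex.I 0 0 i = 0 := by
      rintro ⟨_ | _ | _ | i, hi⟩ h <;> simp [tuple] at h ⊢
    have hl : ∀ (i : Fin N) (e : Bool), (i : ℕ) ≠ 0 →
        letterValue (tuple N Complex.I 0 0) (i, e) = 0 := by
      intro i e hi
      cases e <;> simp [letterValue, h0 i hi]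
    rintro ⟨i, e⟩ ⟨j, f⟩ (hij : i ≠ j)
    by_cases hi : (i : ℕ) = 0
    · rw [hl j f fun hj => hij (Fin.ext (hi.trans hj.symm)), mul_zero, zero_mul, add_zero]
    · rw [hl i e hi, mul_zero, zero_mul, add_zero]
  · rw [map_sub, map_star, eval_z]
    change Complex.I - star Complex.I ≠ 0
    simp [← two_mul]

/-! ### The inclusions -/

theorem satisfies_universal_left {R R' : Set (FreeStarAlg N)} (hR : NormBounding (R ∪ R')) :
    Satisfies R (universal (R ∪ R') hR).coord :=
  (satisfies_union.mp (satisfies_universal _ hR)).1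

theorem satisfies_universal_right {R R' : Set (FreeStarAlg N)} (hR : NormBounding (R ∪ R')) :
    Satisfies R' (universal (R ∪ R') hR).coord :=
  (satisfies_union.mp (satisfies_universal _ hR)).2

/-- The named relation set is definitionally the one in the definition of the sphere, so the facts
about `universal` apply directly; the analogous lemmas below work in the same way. -/
theorem realHalf_coord (N : ℕ) :
    Satisfies (realRel N) (realHalf N).coord ∧ HalfCommuting (realHalf N).coord :=
  ⟨satisfies_universal_left (normBounding_real (realHalfRel N)),
    satisfies_realHalfRel.mp (satisfies_universal_right (normBounding_real (realHalfRel N)))⟩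

theorem realTwist_coord (N : ℕ) :
    Satisfies (realRel N) (realTwist N).coord ∧ Twisted id (realTwist N).coord :=
  ⟨satisfies_universal_left (normBounding_real (realTwistRel N)),
    satisfies_realTwistRel.mp (satisfies_universal_right (normBounding_real (realTwistRel N)))⟩

theorem realTwistHalf_coord (N : ℕ) :
    Satisfies (realRel N) (realTwistHalf N).coord ∧ HalfTwisted id (realTwistHalf N).coord :=
  ⟨satisfies_universal_left (normBounding_real (realTwistHalfRel N)),
    satisfies_realTwistHalfRel.mp
      (satisfies_universal_right (normBounding_real (realTwistHalfRel N)))⟩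

theorem realFree_coord (N : ℕ) : Satisfies (realRel N) (realFree N).coord :=
  satisfies_universal_left (normBounding_real ∅)

theorem complexHalf_coord (N : ℕ) :
    Satisfies (complexRel N) (complexHalf N).coord ∧
      HalfCommuting (letterValue (complexHalf N).coord) :=
  ⟨satisfies_universal_left (normBounding_complex (complexHalfRel N)),
    satisfies_complexHalfRel.mp
      (satisfies_universal_right (normBounding_complex (complexHalfRel N)))⟩

theorem complexTwist_coord (N : ℕ) :
    Satisfies (complexRel N) (complexTwist N).coord ∧
      Twisted Prod.fst (letterValue (complexTwist N).coord) :=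
  ⟨satisfies_universal_left (normBounding_complex (complexTwistRel N)),
    satisfies_complexTwistRel.mp
      (satisfies_universal_right (normBounding_complex (complexTwistRel N)))⟩

theorem complexTwistHalf_coord (N : ℕ) :
    Satisfies (complexRel N) (complexTwistHalf N).coord ∧
      HalfTwisted Prod.fst (letterValue (complexTwistHalf N).coord) :=
  ⟨satisfies_universal_left (normBounding_complex (complexTwistHalfRel N)),
    satisfies_complexTwistHalfRel.mp
      (satisfies_universal_right (normBounding_complex (complexTwistHalfRel N)))⟩

section Satisfies

variable {B : Type*} [CStarAlgebra B] {b : Fin N → B}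

theorem satisfies_complexHalf_of_real (h : Satisfies (realRel N) b) (hh : HalfCommuting b) :
    Satisfies (complexRel N ∪ complexHalfRel N) b := by
  refine satisfies_union.mpr
    ⟨satisfies_complexRel_of_realRel h, satisfies_complexHalfRel.mpr ?_⟩
  rw [letterValue_of_star_eq (satisfies_realRel.mp h).1]
  exact hh.comp _

theorem satisfies_complexTwist_of_real (h : Satisfies (realRel N) b) (hh : Twisted id b) :
    Satisfies (complexRel N ∪ complexTwistRel N) b := by
  refine satisfies_union.mpr
    ⟨satisfies_complexRel_of_realRel h, satisfies_complexTwistRel.mpr ?_⟩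
  rw [letterValue_of_star_eq (satisfies_realRel.mp h).1]
  exact hh.comp _

theorem satisfies_complexTwistHalf_of_real (h : Satisfies (realRel N) b)
    (hh : HalfTwisted id b) : Satisfies (complexRel N ∪ complexTwistHalfRel N) b := by
  refine satisfies_union.mpr
    ⟨satisfies_complexRel_of_realRel h, satisfies_complexTwistHalfRel.mpr ?_⟩
  rw [letterValue_of_star_eq (satisfies_realRel.mp h).1]
  exact hh.comp _

theorem eval_sub_star_of_real (h : Satisfies (realRel N) b) (i : Fin N) :
    eval b (z i - star (z i)) = 0 := h _ (Or.inl ⟨i, rfl⟩)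

end Satisfies

theorem complex_proper_complexHalf (hN : 2 ≤ N) :
    (complex N).ProperSubspace (complexHalf N) := by
  obtain ⟨b, hb, hh, hp⟩ := exists_halfCommuting_not_commuting hN
  refine properSubspace_universal (normBounding_complex (complexHalfRel N))
    (denseRange_eval_complex N) (satisfies_union.mpr ⟨satisfies_complex N,
      satisfies_complexHalfRel.mpr ?_⟩) ?_ (satisfies_complexHalf_of_real hb hh) hp
  -- The carrier `(complex N).fn` only shows a C*-algebra; naming the function algebra makes its
  -- commutativity available.
  · exact halfCommuting_of_comm (B := C(Metric.sphere (0 : EuclideanSpace ℂ (Fin N)) 1, ℂ)) _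
  · rw [map_sub, map_mul, map_mul, sub_eq_zero]
    exact mul_comm (G := C(Metric.sphere (0 : EuclideanSpace ℂ (Fin N)) 1, ℂ)) _ _

theorem complexHalf_proper_complexFree (hN : 2 ≤ N) :
    (complexHalf N).ProperSubspace (complexFree N) := by
  obtain ⟨b, hb, hp⟩ := exists_not_halfCommuting hN
  refine properSubspace_universal (normBounding_complex ∅) (denseRange_eval_universal _ _)
    (satisfies_union.mpr ⟨(complexHalf_coord N).1, satisfies_empty _⟩) ?_
    (satisfies_union.mpr ⟨hb, satisfies_empty _⟩) hp
  simpa [letterValue] using (complexHalf_coord N).2 (idx₀ hN, false) (idx₀ hN, false)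
    (idx₁ hN, false)

theorem complexTwistHalf_proper_complexFree (hN : 2 ≤ N) :
    (complexTwistHalf N).ProperSubspace (complexFree N) := by
  obtain ⟨b, hb, hp⟩ := exists_not_halfCommuting hN
  refine properSubspace_universal (normBounding_complex ∅) (denseRange_eval_universal _ _)
    (satisfies_union.mpr ⟨(complexTwistHalf_coord N).1, satisfies_empty _⟩) ?_
    (satisfies_union.mpr ⟨hb, satisfies_empty _⟩) hp
  -- The repeated first index selects the branch without sign.
  simpa [letterValue] using (complexTwistHalf_coord N).2.2 (idx₀ hN, false) (idx₀ hN, false)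
    (idx₁ hN, false) (by simp)

theorem complexTwist_proper_complexTwistHalf (hN : 2 ≤ N) :
    (complexTwist N).ProperSubspace (complexTwistHalf N) := by
  obtain ⟨b, hb, hh, hp⟩ := exists_halfTwisted_not_twisted hN
  refine properSubspace_universal (normBounding_complex (complexTwistHalfRel N))
    (denseRange_eval_universal _ _) (satisfies_union.mpr ⟨(complexTwist_coord N).1,
      satisfies_complexTwistHalfRel.mpr (complexTwist_coord N).2.halfTwisted⟩) ?_
    (satisfies_complexTwistHalf_of_real hb hh) hp
  simpa [letterValue] using (complexTwist_coord N).2.1 (idx₀ hN, false) (idx₁ hN, false)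
    (by simp [idx₀, idx₁])

theorem real_proper_realHalf (hN : 2 ≤ N) : (real N).ProperSubspace (realHalf N) := by
  obtain ⟨b, hb, hh, hp⟩ := exists_halfCommuting_not_commuting hN
  refine properSubspace_universal (normBounding_real (realHalfRel N))
    (denseRange_eval_real N) (satisfies_union.mpr ⟨satisfies_real N,
      satisfies_realHalfRel.mpr ?_⟩) ?_
    (satisfies_union.mpr ⟨hb, satisfies_realHalfRel.mpr hh⟩) hp
  · exact halfCommuting_of_comm (B := C(Metric.sphere (0 : EuclideanSpace ℝ (Fin N)) 1, ℂ)) _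
  · rw [map_sub, map_mul, map_mul, sub_eq_zero]
    exact mul_comm (G := C(Metric.sphere (0 : EuclideanSpace ℝ (Fin N)) 1, ℂ)) _ _

theorem realHalf_proper_realFree (hN : 3 ≤ N) : (realHalf N).ProperSubspace (realFree N) := by
  obtain ⟨b, hb, hp⟩ := exists_real_not_halfCommuting hN
  refine properSubspace_universal (normBounding_real ∅) (denseRange_eval_universal _ _)
    (satisfies_union.mpr ⟨(realHalf_coord N).1, satisfies_empty _⟩) ?_
    (satisfies_union.mpr ⟨hb, satisfies_empty _⟩) hp
  simpa using (realHalf_coord N).2 (idx₀ (by omega)) (idx₁ (by omega)) (idx₂ hN)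

theorem realTwistHalf_proper_realFree (hN : 3 ≤ N) :
    (realTwistHalf N).ProperSubspace (realFree N) := by
  obtain ⟨b, hb, hp⟩ := exists_real_not_halfTwisted hN
  refine properSubspace_universal (normBounding_real ∅) (denseRange_eval_universal _ _)
    (satisfies_union.mpr ⟨(realTwistHalf_coord N).1, satisfies_empty _⟩) ?_
    (satisfies_union.mpr ⟨hb, satisfies_empty _⟩) hp
  simpa using (realTwistHalf_coord N).2.1 (idx₀ (by omega)) (idx₁ (by omega)) (idx₂ hN)
    (by simp [idx₀, idx₁, idx₂])

theorem realTwist_proper_realTwistHalf (hN : 2 ≤ N) :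
    (realTwist N).ProperSubspace (realTwistHalf N) := by
  obtain ⟨b, hb, hh, hp⟩ := exists_halfTwisted_not_twisted hN
  refine properSubspace_universal (normBounding_real (realTwistHalfRel N))
    (denseRange_eval_universal _ _) (satisfies_union.mpr ⟨(realTwist_coord N).1,
      satisfies_realTwistHalfRel.mpr (realTwist_coord N).2.halfTwisted⟩) ?_
    (satisfies_union.mpr ⟨hb, satisfies_realTwistHalfRel.mpr hh⟩) hp
  simpa using (realTwist_coord N).2.1 (idx₀ hN) (idx₁ hN) (by simp [idx₀, idx₁])

/-- Here the larger algebra is not presented by relations, so the morphism is built by hand, as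
restriction of functions along the embedding of the real sphere. -/
theorem real_proper_complex (hN : 2 ≤ N) : (real N).ProperSubspace (complex N) := by
  let ι : C(Metric.sphere (0 : EuclideanSpace ℝ (Fin N)) 1,
      Metric.sphere (0 : EuclideanSpace ℂ (Fin N)) 1) :=
    { toFun := fun x => ⟨WithLp.toLp 2 fun i => ((x.1 i : ℝ) : ℂ), by
        have hx := norm_eq_of_mem_sphere x
        rw [EuclideanSpace.norm_eq] at hx
        rw [mem_sphere_zero_iff_norm, EuclideanSpace.norm_eq]
        simpa using hx⟩
      continuous_toFun := by fun_prop }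
  let φ : (complex N).fn →⋆ₐ[ℂ] (real N).fn := ContinuousMap.compStarAlgHom' ℂ ℂ ι
  have hφ : ∀ i, φ ((complex N).coord i) = (real N).coord i := fun i => rfl
  refine ⟨φ, hφ, φ.surjective_of_denseRange ?_, fun hinj => ?_⟩
  · refine (denseRange_eval_real N).mono ?_
    rintro _ ⟨a, rfl⟩
    exact ⟨eval (complex N).coord a, by rw [map_eval, funext hφ]⟩
  · have h0 : eval (complex N).coord (z (idx₀ hN) - star (z (idx₀ hN))) = 0 := by
      apply hinj
      rw [map_eval, funext hφ, eval_sub_star_of_real (satisfies_real N), map_zero]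
    -- The function `z₀ - z₀*` vanishes on the real sphere but equals `2i` at this point, which has
    -- first coordinate `i` and the others zero.
    let x : Metric.sphere (0 : EuclideanSpace ℂ (Fin N)) 1 :=
      ⟨EuclideanSpace.single (idx₀ hN) Complex.I, by simp⟩
    have h1 : (complex N).coord (idx₀ hN) - star ((complex N).coord (idx₀ hN)) = 0 := by
      simpa [map_star] using h0
    have h2 : x.1 (idx₀ hN) - starRingEnd ℂ (x.1 (idx₀ hN)) = 0 :=
      congrArg (fun f : C(Metric.sphere (0 : EuclideanSpace ℂ (Fin N)) 1, ℂ) => f x) h1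
    simp [x, ← two_mul] at h2

theorem realHalf_proper_complexHalf (hN : 2 ≤ N) :
    (realHalf N).ProperSubspace (complexHalf N) := by
  obtain ⟨b, hb, -, hp⟩ := exists_not_selfAdjoint hN
  have hX := realHalf_coord N
  exact properSubspace_universal (normBounding_complex (complexHalfRel N))
    (denseRange_eval_universal _ _) (satisfies_complexHalf_of_real hX.1 hX.2)
    (eval_sub_star_of_real hX.1 _)
    (satisfies_union.mpr ⟨hb, satisfies_complexHalfRel.mpr (halfCommuting_of_comm _)⟩) hp

theorem realFree_proper_complexFree (hN : 2 ≤ N) :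
    (realFree N).ProperSubspace (complexFree N) := by
  obtain ⟨b, hb, -, hp⟩ := exists_not_selfAdjoint hN
  have hX := realFree_coord N
  exact properSubspace_universal (normBounding_complex ∅) (denseRange_eval_universal _ _)
    (satisfies_union.mpr ⟨satisfies_complexRel_of_realRel hX, satisfies_empty _⟩)
    (eval_sub_star_of_real hX _) (satisfies_union.mpr ⟨hb, satisfies_empty _⟩) hp

theorem realTwistHalf_proper_complexTwistHalf (hN : 2 ≤ N) :
    (realTwistHalf N).ProperSubspace (complexTwistHalf N) := by
  obtain ⟨b, hb, hh, hp⟩ := exists_not_selfAdjoint hN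
  have hX := realTwistHalf_coord N
  exact properSubspace_universal (normBounding_complex (complexTwistHalfRel N))
    (denseRange_eval_universal _ _) (satisfies_complexTwistHalf_of_real hX.1 hX.2)
    (eval_sub_star_of_real hX.1 _)
    (satisfies_union.mpr ⟨hb, satisfies_complexTwistHalfRel.mpr hh.halfTwisted⟩) hp

theorem realTwist_proper_complexTwist (hN : 2 ≤ N) :
    (realTwist N).ProperSubspace (complexTwist N) := by
  obtain ⟨b, hb, hh, hp⟩ := exists_not_selfAdjoint hN
  have hX := realTwist_coord N
  exact properSubspace_universal (normBounding_complex (complexTwistRel N))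
    (denseRange_eval_universal _ _) (satisfies_complexTwist_of_real hX.1 hX.2)
    (eval_sub_star_of_real hX.1 _)
    (satisfies_union.mpr ⟨hb, satisfies_complexTwistRel.mpr hh⟩) hp

/-! ### The equalities for two coordinates -/

/-- For two coordinates the half-commutation relations follow from those of the free sphere. -/
theorem halfCommuting_of_two {B : Type*} [CStarAlgebra B] {b : Fin 2 → B}
    (h : Satisfies (realRel 2) b) : HalfCommuting b := by
  have hs := (satisfies_realRel.mp h).2
  rw [Fin.sum_univ_two, pow_two, pow_two] at hs
  have h0 : b 0 * b 0 = 1 - b 1 * b 1 := eq_sub_of_add_eq hs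
  have h1 : b 1 * b 1 = 1 - b 0 * b 0 := eq_sub_of_add_eq' hs
  -- The square of `b 0` is a polynomial in `b 1`, so it commutes with `b 1`.
  have h01 : b 0 * b 0 * b 1 = b 1 * (b 0 * b 0) := by
    rw [h0, sub_mul, mul_sub, one_mul, mul_one, mul_assoc]
  have h10 : b 1 * b 1 * b 0 = b 0 * (b 1 * b 1) := by
    rw [h1, sub_mul, mul_sub, one_mul, mul_one, mul_assoc]
  intro i j k
  -- Four of the eight words are palindromes; the other four are instances of `h01` and `h10` up to
  -- reassociation.
  fin_cases i <;> fin_cases j <;> fin_cases k <;>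
    simp [h01, h10, mul_assoc (b 1) (b 0) (b 0), mul_assoc (b 0) (b 1) (b 1)]

/-- Three distinct indices do not exist in `Fin 2`, so only the branch without sign remains. -/
theorem halfTwisted_of_two {B : Type*} [CStarAlgebra B] {b : Fin 2 → B}
    (h : Satisfies (realRel 2) b) : HalfTwisted id b := by
  refine ⟨fun i j k ⟨h1, h2, h3⟩ => ?_, fun i j k _ => halfCommuting_of_two h i j k⟩
  simp only [id] at h1 h2 h3
  omega

/-- Both extra families of relations follow from the real sphere relations, so the three real
presentations have the same models when `N = 2`. -/
theorem realHalf_two_same_realTwistHalf : (realHalf 2).Same (realTwistHalf 2) :=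
  same_universal (normBounding_real (realHalfRel 2)) (normBounding_real (realTwistHalfRel 2))
    (satisfies_union.mpr ⟨(realHalf_coord 2).1,
      satisfies_realTwistHalfRel.mpr (halfTwisted_of_two (realHalf_coord 2).1)⟩)
    (satisfies_union.mpr ⟨(realTwistHalf_coord 2).1,
      satisfies_realHalfRel.mpr (halfCommuting_of_two (realTwistHalf_coord 2).1)⟩)

theorem realTwistHalf_two_same_realFree : (realTwistHalf 2).Same (realFree 2) :=
  same_universal (normBounding_real (realTwistHalfRel 2)) (normBounding_real ∅)
    (satisfies_union.mpr ⟨(realTwistHalf_coord 2).1, satisfies_empty _⟩)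
    (satisfies_union.mpr ⟨realFree_coord 2,
      satisfies_realTwistHalfRel.mpr (halfTwisted_of_two (realFree_coord 2))⟩)

theorem realHalf_two_same_realFree : (realHalf 2).Same (realFree 2) :=
  same_universal (normBounding_real (realHalfRel 2)) (normBounding_real ∅)
    (satisfies_union.mpr ⟨(realHalf_coord 2).1, satisfies_empty _⟩)
    (satisfies_union.mpr ⟨realFree_coord 2,
      satisfies_realHalfRel.mpr (halfCommuting_of_two (realFree_coord 2))⟩)

end Sphere

end

theorem theorem1p7 :
    -- For `N ≥ 3` all the 13 inclusions of the diagram are proper.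
    (∀ N : ℕ, 3 ≤ N →
      -- the upper row
      (Sphere.complex N).ProperSubspace (Sphere.complexHalf N) ∧
      (Sphere.complexHalf N).ProperSubspace (Sphere.complexFree N) ∧
      (Sphere.complexTwistHalf N).ProperSubspace (Sphere.complexFree N) ∧
      (Sphere.complexTwist N).ProperSubspace (Sphere.complexTwistHalf N) ∧
      -- the lower row
      (Sphere.real N).ProperSubspace (Sphere.realHalf N) ∧
      (Sphere.realHalf N).ProperSubspace (Sphere.realFree N) ∧
      (Sphere.realTwistHalf N).ProperSubspace (Sphere.realFree N) ∧
      (Sphere.realTwist N).ProperSubspace (Sphere.realTwistHalf N) ∧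
      -- the vertical inclusions
      (Sphere.real N).ProperSubspace (Sphere.complex N) ∧
      (Sphere.realHalf N).ProperSubspace (Sphere.complexHalf N) ∧
      (Sphere.realFree N).ProperSubspace (Sphere.complexFree N) ∧
      (Sphere.realTwistHalf N).ProperSubspace (Sphere.complexTwistHalf N) ∧
      (Sphere.realTwist N).ProperSubspace (Sphere.complexTwist N)) ∧
    -- For `N = 2` two of them are equalities, and the other 11 are proper.
    ((Sphere.realHalf 2).Same (Sphere.realTwistHalf 2) ∧
      (Sphere.realTwistHalf 2).Same (Sphere.realFree 2) ∧
      (Sphere.realHalf 2).Same (Sphere.realFree 2) ∧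
      -- the upper row
      (Sphere.complex 2).ProperSubspace (Sphere.complexHalf 2) ∧
      (Sphere.complexHalf 2).ProperSubspace (Sphere.complexFree 2) ∧
      (Sphere.complexTwistHalf 2).ProperSubspace (Sphere.complexFree 2) ∧
      (Sphere.complexTwist 2).ProperSubspace (Sphere.complexTwistHalf 2) ∧
      -- the lower row
      (Sphere.real 2).ProperSubspace (Sphere.realHalf 2) ∧
      (Sphere.realTwist 2).ProperSubspace (Sphere.realTwistHalf 2) ∧
      -- the vertical inclusions
      (Sphere.real 2).ProperSubspace (Sphere.complex 2) ∧
      (Sphere.realHalf 2).ProperSubspace (Sphere.complexHalf 2) ∧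
      (Sphere.realFree 2).ProperSubspace (Sphere.complexFree 2) ∧
      (Sphere.realTwistHalf 2).ProperSubspace (Sphere.complexTwistHalf 2) ∧
      (Sphere.realTwist 2).ProperSubspace (Sphere.complexTwist 2)) := by
  refine ⟨fun N hN => ?_, ?_⟩
  -- Only the two inclusions into the free real sphere need three coordinates.
  · have h2 : 2 ≤ N := by omega
    exact ⟨Sphere.complex_proper_complexHalf h2,
      Sphere.complexHalf_proper_complexFree h2,
      Sphere.complexTwistHalf_proper_complexFree h2,
      Sphere.complexTwist_proper_complexTwistHalf h2,
      Sphere.real_proper_realHalf h2,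
      Sphere.realHalf_proper_realFree hN,
      Sphere.realTwistHalf_proper_realFree hN,
      Sphere.realTwist_proper_realTwistHalf h2,
      Sphere.real_proper_complex h2,
      Sphere.realHalf_proper_complexHalf h2,
      Sphere.realFree_proper_complexFree h2,
      Sphere.realTwistHalf_proper_complexTwistHalf h2,
      Sphere.realTwist_proper_complexTwist h2⟩
  · exact ⟨Sphere.realHalf_two_same_realTwistHalf,
      Sphere.realTwistHalf_two_same_realFree,
      Sphere.realHalf_two_same_realFree,
      Sphere.complex_proper_complexHalf le_rfl,
      Sphere.complexHalf_proper_complexFree le_rfl,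
      Sphere.complexTwistHalf_proper_complexFree le_rfl,
      Sphere.complexTwist_proper_complexTwistHalf le_rfl,
      Sphere.real_proper_realHalf le_rfl,
      Sphere.realTwist_proper_realTwistHalf le_rfl,
      Sphere.real_proper_complex le_rfl,
      Sphere.realHalf_proper_complexHalf le_rfl,
      Sphere.realFree_proper_complexFree le_rfl,
      Sphere.realTwistHalf_proper_complexTwistHalf le_rfl,
      Sphere.realTwist_proper_complexTwist le_rfl⟩
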